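/- Let $\rho$ be a probability measure on $\mathcal X\times\{\pm1\}$, where $\mathcal X\subset\mathbb R^d$ is bounded, such that $p=\Pr(y=1)\in(0,1)$. Put $$f(w)=p(1-p)\,\mathbb E\big[(1-w^\top(x-x'))^2\,\big|\,y=1,\,y'=-1\big],\qquad \phi=f+\Omega,$$ where $(x,y),(x',y')$ are independent with law $\rho$ and $\Omega:\mathbb R^d\to[0,\infty)$ is convex with $\Omega(0)=0$. Assume that $\phi$ has a minimizer and that there are $A_1,A_2\ge 0$ such that every $w$ admits a subgradient $\Omega'(w)$ of $\Omega$ at $w$ with $\|\Omega'(w)\|_2^2\le A_1\Omega(w)+A_2$. Let $\kappa=\max\{1,\sup_{x\in\mathcal X}\|x\|_2\}$ and $C_1=\max\{A_1,16\kappa^2\}$. Let $z_t=(x_t,y_t)$, $t=0,1,2,\dots$, be independent with law $\rho$. For $t\ge1$ let $p_t=\frac1t\#\{i<t:y_i=1\}$, and let $u_t$ and $v_t$ be the averages of the $x_i$ over $\{i<t: y_i=1\}$ and over $\{i<t:y_i=-1\}$ respectively (an average over the empty set being $0$). Let $$\begin{aligned}\hat F_t(w;(x,y))={}&(1-p_t)\big(w^\top(x-u_t)\big)^2\mathbb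 I_{[y=1]}+p_t\big(w^\top(x-v_t)\big)^2\mathbb I_{[y=-1]}\\&+2p_t(1-p_t)\,w^\top(v_t-u_t)+p_t(1-p_t)\big(w^\top(v_t-u_t)\big)^2+p_t(1-p_t)\end{aligned}$$ and denote by $\hat F_t'$ its gradient in $w$. For step sizes $\eta_t>0$, the SPAUC iterates are $w_1=0$ and $$w_{t+1}=\arg\min_{w\in\mathbb R^d}\ \eta_t\langle w-w_t,\hat F_t'(w_t;z_t)\rangle+\eta_t\Omega(w)+\tfrac12\|w-w_t\|_2^2,\qquad t\ge1,$$ and $\bar w_T=\sum_{t=1}^T\eta_tw_t\big/\sum_{t=1}^T\eta_t$. Let $0<\eta_1\le(2C_1)^{-1}$ and $\delta\in(0,1)$. 1. If $\eta_t=\eta_1t^{-\theta}$ with $\theta>1/2$, then there is a constant $C$ independent of $T$ such that, for every $T\ge1$, with probability at least $1-\delta$, $$\phi(\bar w_T)-\inf_w\phi(w)\le C\,T^{\theta-1}\log^{3/2}\frac T\delta .$$ 2. If $\eta_t=\eta_1\big(t\log^\beta(et)\big)^{-1/2}$ with $\beta>2$, then there is a constant $C$ independent of $T$ such that, for every $T\ge1$,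 with probability at least $1-\delta$, $$\phi(\bar w_T)-\inf_w\phi(w)\le C\,T^{-1/2}\log^{(3+\beta)/2}\frac T\delta .$$ In both parts $C$ is a deterministic constant that may depend on $\rho,\mathcal X,\Omega,A_1,A_2$, the step-size parameters and $\delta$, but not on $T$ or on the sample. -/

import Mathlib

open MeasureTheory ProbabilityTheory

universe u

noncomputable section

namespace SPAUC

/-- The parameter and input space `ℝ^d` with its Euclidean norm. -/
abbrev E (d : ℕ) : Type := EuclideanSpace ℝ (Fin d)

/-- Examples `z = (x, y)`; the label set `{1, -1}` is the group of units of `ℤ`. -/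
abbrev Example (d : ℕ) : Type := E d × ℤˣ

variable {d : ℕ}

/-! ### The objective -/

/-- `p = Pr(y = 1)`. -/
def posProb (ρ : Measure (Example d)) : ℝ := ρ.real {z | z.2 = 1}

/-- `f(w) = p (1 - p) E[(1 - wᵀ(x - x'))² | y = 1, y' = -1]`, where `(x, y)` and `(x', y')` are
independent with law `ρ`. -/
def aucRisk (ρ : Measure (Example d)) (w : E d) : ℝ :=
  posProb ρ * (1 - posProb ρ) *
    ∫ q, (1 - inner ℝ w (q.1.1 - q.2.1)) ^ 2
      ∂(cond (ρ.prod ρ) {q : Example d × Example d | q.1.2 = 1 ∧ q.2.2 = -1})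

/-- `φ = f + Ω`. -/
def objective (ρ : Measure (Example d)) (Ω : E d → ℝ) (w : E d) : ℝ := aucRisk ρ w + Ω w

/-- The set `S*` of minimizers of `φ`. -/
def minimizers (φ : E d → ℝ) : Set (E d) := {w | ∀ u, φ w ≤ φ u}

/-! ### Regularizers -/

/-- `g` is a subgradient of `Ω` at `w`. -/
def IsSubgradient (Ω : E d → ℝ) (w g : E d) : Prop :=
  ∀ u, Ω w + inner ℝ (u - w) g ≤ Ω u

/-- At every `w` there is a subgradient `Ω'(w)` with `‖Ω'(w)‖² ≤ A₁ Ω(w) + A₂`. -/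
def SelfBounding (Ω : E d → ℝ) (A₁ A₂ : ℝ) : Prop :=
  ∀ w, ∃ g, IsSubgradient Ω w g ∧ ‖g‖ ^ 2 ≤ A₁ * Ω w + A₂

/-- `κ = max {1, sup_{x ∈ X} ‖x‖}`. -/
def kappa (X : Set (E d)) : ℝ := max 1 (sSup ((fun x => ‖x‖) '' X))

/-- `C₁ = max {A₁, 16 κ²}`. -/
def constC₁ (X : Set (E d)) (A₁ : ℝ) : ℝ := max A₁ (16 * kappa X ^ 2)

/-! ### The stochastic gradient -/

/-- Pointwise loss with class probability `p` and class means `u` (positive), `v` (negative):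
`(1-p)(wᵀ(x-u))² 1[y=1] + p (wᵀ(x-v))² 1[y=-1] + 2p(1-p) wᵀ(v-u) + p(1-p)(wᵀ(v-u))² + p(1-p)`. -/
def loss (p : ℝ) (u v : E d) (z : Example d) (w : E d) : ℝ :=
  (1 - p) * (inner ℝ w (z.1 - u)) ^ 2 * (if z.2 = 1 then 1 else 0)
    + p * (inner ℝ w (z.1 - v)) ^ 2 * (if z.2 = -1 then 1 else 0)
    + 2 * p * (1 - p) * inner ℝ w (v - u)
    + p * (1 - p) * (inner ℝ w (v - u)) ^ 2
    + p * (1 - p)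

/-- The gradient of `loss p u v z` at `w` (see `hasGradientAt_loss`). -/
def lossGrad (p : ℝ) (u v : E d) (z : Example d) (w : E d) : E d :=
  (2 * (1 - p) * inner ℝ w (z.1 - u) * (if z.2 = 1 then 1 else 0)) • (z.1 - u)
    + (2 * p * inner ℝ w (z.1 - v) * (if z.2 = -1 then 1 else 0)) • (z.1 - v)
    + (2 * p * (1 - p)) • (v - u)
    + (2 * p * (1 - p) * inner ℝ w (v - u)) • (v - u)

theorem hasGradientAt_loss (p : ℝ) (u v : E d) (z : Example d) (w : E d) :
    HasGradientAt (loss p u v z) (lossGrad p u v z w) w := by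
  rw [hasGradientAt_iff_hasFDerivAt]
  have h : ∀ a : E d, HasFDerivAt (fun w : E d => (inner ℝ w a : ℝ)) (innerSL ℝ a) w := by
    intro a
    have := (innerSL ℝ a).hasFDerivAt (x := w)
    refine this.congr_of_eventuallyEq (Filter.Eventually.of_forall fun y => ?_)
    simp [real_inner_comm]
  have key := ((((((h (z.1 - u)).pow 2).const_mul (1 - p)).mul_const
      (if z.2 = 1 then (1 : ℝ) else 0)).add
    ((((h (z.1 - v)).pow 2).const_mul p).mul_const (if z.2 = -1 then (1 : ℝ) else 0))).add
    ((h (v - u)).const_mul (2 * p * (1 - p)))).add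
    (((h (v - u)).pow 2).const_mul (p * (1 - p)))
  refine (key.add_const (p * (1 - p))).congr_fderiv ?_
  ext y
  simp only [lossGrad, add_apply, smul_apply,
    innerSL_apply_apply, InnerProductSpace.toDual_apply_apply, inner_add_left, inner_smul_left,
    smul_eq_mul, nsmul_eq_mul]
  simp
  ring_nf

/-- `p_t`, the frequency of the label `1` among `z_0, …, z_{t-1}`. -/
def empProb (z : ℕ → Example d) (t : ℕ) : ℝ :=
  (∑ i ∈ Finset.range t, if (z i).2 = 1 then (1 : ℝ) else 0) / t

/-- The mean input of the examples with label `y` among `z_0, …, z_{t-1}` (`0` if there are none).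
Thus `u_t = empMean 1 z t` and `v_t = empMean (-1) z t`. -/
def empMean (y : ℤˣ) (z : ℕ → Example d) (t : ℕ) : E d :=
  (∑ i ∈ Finset.range t, if (z i).2 = y then (1 : ℝ) else 0)⁻¹ •
    ∑ i ∈ Finset.range t, if (z i).2 = y then (z i).1 else 0

/-- The stochastic gradient `F̂'_t(w; z_t)`. -/
def stochGrad (z : ℕ → Example d) (t : ℕ) (w : E d) : E d :=
  lossGrad (empProb z t) (empMean 1 z t) (empMean (-1) z t) (z t) w

/-! ### The algorithm -/

/-- `w_1, w_2, …` are the iterates of the stochastic proximal algorithm on the data stream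
`z_0, z_1, …` with step sizes `η_1, η_2, …`: `w_1 = 0` and, for `t ≥ 1`, `w_{t+1}` minimizes
`η_t ⟨w - w_t, F̂'_t(w_t; z_t)⟩ + η_t Ω(w) + ‖w - w_t‖² / 2` over `w ∈ ℝ^d`. -/
def IsIterates (Ω : E d → ℝ) (η : ℕ → ℝ) (z : ℕ → Example d) (w : ℕ → E d) : Prop :=
  w 1 = 0 ∧ ∀ t, 1 ≤ t → ∀ u : E d,
    η t * inner ℝ (w (t + 1) - w t) (stochGrad z t (w t)) + η t * Ω (w (t + 1))
        + 1 / 2 * ‖w (t + 1) - w t‖ ^ 2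
      ≤ η t * inner ℝ (u - w t) (stochGrad z t (w t)) + η t * Ω u + 1 / 2 * ‖u - w t‖ ^ 2

/-- The weighted average `(∑_{t=1}^T η_t w_t) / ∑_{t=1}^T η_t`. -/
def average (η : ℕ → ℝ) (w : ℕ → E d) (T : ℕ) : E d :=
  (∑ t ∈ Finset.Icc 1 T, η t)⁻¹ • ∑ t ∈ Finset.Icc 1 T, η t • w t

/-- `z_0, z_1, …` are independent random examples with law `ρ`. -/
structure IsSample {S : Type*} [MeasurableSpace S] (P : Measure S) (ρ : Measure (Example d))
    (z : ℕ → S → Example d) : Prop where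
  measurable : ∀ t, Measurable (z t)
  law : ∀ t, P.map (z t) = ρ
  indep : iIndepFun z P

end SPAUC

end

noncomputable section

namespace SPAUC

variable {d : ℕ}

/-! ### The proximal operator -/

/-! Fix a minimizer v₀ of φ and write D_t = 1 + ‖w_t - v₀‖² and b_t for the total error of p_t, u_t,
v_t (`classError`). With the true class probability and class means in place of the estimates, the
loss is an unbiased one-sample estimate of f (`integral_loss_eq_aucRisk`), and it is Lipschitz in
these parameters (`abs_loss_sub_loss_le`). So each iteration is a convex stochastic proximal step
with bias of order b_t, and given the past E[D_{t+1}] + η_t (φ(w_t) - φ(v₀)) ≤ (1 + g_t) D_t, where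
g_t = K (η_t b_t + η_t²) (`exists_isStepConstant`).

The factor 1 + g_t is random, but it is known before z_t is drawn. Dividing by Q_{t+1} = ∏_{i ≤ t}
(1 + g_i) therefore makes the recursion telescope in expectation: ∑ E[η_t (φ(w_t) - φ(v₀)) /
Q_{t+1}] ≤ 1 + ‖v₀‖² (`sum_lintegral_weighted_le`). No a priori bound on the iterates is needed.

Since E[b_t] = O(t^{-1/2}) (`exists_lintegral_classError_le`), E[∑ g_t] is at most a multiple of ∑
(η_t / √t + η_t²), which is bounded for both step-size families. Markov's inequality, once for the
weighted sum and once for ∑ g_t, together with Q ≤ exp(∑ g_t), bounds ∑ η_t (φ(w_t) - φ(v₀)) with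
probability 1 - δ by a constant free of T (`exists_prob_weighted_sum_le`). As C may depend on δ, no
exponential concentration is needed.

Jensen's inequality and ∑ η_t ≥ T η_T then give the rates. The logarithms enter only through log
(T/δ) ≥ log (1/δ) > 0 and, in the second part, to dominate log^{β/2} (eT). -/

/-- `m` minimizes `η Ω + ‖· - y‖² / 2`. -/
def IsProx (Ω : E d → ℝ) (η : ℝ) (y m : E d) : Prop :=
  ∀ u, η * Ω m + 1 / 2 * ‖m - y‖ ^ 2 ≤ η * Ω u + 1 / 2 * ‖u - y‖ ^ 2

/-- A convex function on a finite-dimensional space is continuous, and the quadratic term makes the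
objective coercive because Ω ≥ 0. -/
theorem exists_isProx {Ω : E d → ℝ} (hconv : ConvexOn ℝ Set.univ Ω) (hnonneg : ∀ w, 0 ≤ Ω w)
    {η : ℝ} (hη : 0 ≤ η) (y : E d) : ∃ m, IsProx Ω η y m := by
  have hc : Continuous Ω := hconv.locallyLipschitz.continuous
  refine Continuous.exists_forall_le (f := fun m => η * Ω m + 1 / 2 * ‖m - y‖ ^ 2)
    (by fun_prop) ?_
  have h1 : Filter.Tendsto (fun m : E d => ‖m - y‖) (Filter.cocompact _) Filter.atTop := by
    have := (Homeomorph.subRight y).isClosedEmbedding.tendsto_cocompact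
    exact tendsto_norm_cocompact_atTop.comp this
  have h2 : Filter.Tendsto (fun m : E d => 1 / 2 * ‖m - y‖ ^ 2) (Filter.cocompact _)
      Filter.atTop :=
    ((Filter.tendsto_pow_atTop two_ne_zero).comp h1).const_mul_atTop (by norm_num)
  refine Filter.tendsto_atTop_mono (fun m => ?_) h2
  have := mul_nonneg hη (hnonneg m)
  linarith

/-- The quadratic term makes the objective strongly convex. Compare m with m + l (u - m), divide by
l and let l tend to 0. -/
theorem IsProx.three_point {Ω : E d → ℝ} (hconv : ConvexOn ℝ Set.univ Ω) {η : ℝ} (hη : 0 ≤ η)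
    {y m : E d} (hm : IsProx Ω η y m) (u : E d) :
    η * Ω m + 1 / 2 * ‖m - y‖ ^ 2 + 1 / 2 * ‖u - m‖ ^ 2 ≤ η * Ω u + 1 / 2 * ‖u - y‖ ^ 2 := by
  have key : ∀ l : ℝ, 0 < l → l < 1 →
      η * Ω m + 1 / 2 * ‖m - y‖ ^ 2 + 1 / 2 * ‖u - m‖ ^ 2 ≤
        η * Ω u + 1 / 2 * ‖u - y‖ ^ 2 + l * (1 / 2 * ‖u - m‖ ^ 2) := by
    intro l h0 h1
    have ha := hm (m + l • (u - m))
    have hb : Ω (m + l • (u - m)) ≤ (1 - l) * Ω m + l * Ω u := by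
      have := hconv.2 (Set.mem_univ m) (Set.mem_univ u) (sub_nonneg.2 h1.le) h0.le (by ring)
      have e : m + l • (u - m) = (1 - l) • m + l • u := by module
      rw [e]
      simpa using this
    have hc := mul_le_mul_of_nonneg_left hb hη
    have e1 : ‖m + l • (u - m) - y‖ ^ 2 =
        ‖m - y‖ ^ 2 + 2 * (l * inner ℝ (m - y) (u - m)) + l ^ 2 * ‖u - m‖ ^ 2 := by
      have : m + l • (u - m) - y = (m - y) + l • (u - m) := by abel
      rw [this, norm_add_sq_real, inner_smul_right, norm_smul, mul_pow]
      simp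
    have e2 : ‖u - y‖ ^ 2 =
        ‖m - y‖ ^ 2 + 2 * inner ℝ (m - y) (u - m) + ‖u - m‖ ^ 2 := by
      have : u - y = (m - y) + (u - m) := by abel
      rw [this, norm_add_sq_real]
    rw [e1] at ha
    rw [e2]
    have : 0 ≤ l * (η * Ω u - η * Ω m + inner ℝ (m - y) (u - m) + l * (1 / 2 * ‖u - m‖ ^ 2)) := by
      nlinarith
    have := nonneg_of_mul_nonneg_right this h0
    linarith
  refine le_of_forall_pos_le_add fun ε hε => ?_
  set N := 1 / 2 * ‖u - m‖ ^ 2 with hN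
  have hN0 : 0 ≤ N := by positivity
  -- This l keeps l < 1 and l N ≤ ε; the N + 1 covers N = 0.
  have hl : 0 < min (1 / 2) (ε / (N + 1)) := by positivity
  refine (key _ hl ((min_le_left _ _).trans_lt (by norm_num))).trans ?_
  have : min (1 / 2) (ε / (N + 1)) * N ≤ ε / (N + 1) * (N + 1) :=
    mul_le_mul (min_le_right _ _) (by linarith) hN0 (by positivity)
  rw [div_mul_cancel₀ _ (by positivity)] at this
  linarith

/-- Testing each minimizer in the other's three-point inequality and adding cancels Ω and leaves ‖m
- m'‖² ≤ ⟨m - m', y - y'⟩. This yields both uniqueness (y = y') and continuity of the proximal map.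
-/
theorem IsProx.norm_sub_le {Ω : E d → ℝ} (hconv : ConvexOn ℝ Set.univ Ω) {η : ℝ} (hη : 0 ≤ η)
    {y m y' m' : E d} (hm : IsProx Ω η y m) (hm' : IsProx Ω η y' m') :
    ‖m - m'‖ ≤ ‖y - y'‖ := by
  have h1 := hm.three_point hconv hη m'
  have h2 := hm'.three_point hconv hη m
  have e : ‖m' - y‖ ^ 2 - ‖m - y‖ ^ 2 + ‖m - y'‖ ^ 2 - ‖m' - y'‖ ^ 2
      = 2 * inner ℝ (m - m') (y - y') := by
    simp only [← real_inner_self_eq_norm_sq, inner_sub_left, inner_sub_right]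
    rw [real_inner_comm y m', real_inner_comm y m, real_inner_comm y' m, real_inner_comm y' m']
    ring
  have h3 := real_inner_le_norm (m - m') (y - y')
  rw [norm_sub_rev m' m] at h1
  by_contra! h
  have h4 : 0 < ‖m - m'‖ := (norm_nonneg _).trans_lt h
  nlinarith

/-- The proximal operator of `η Ω`. -/
def prox (Ω : E d → ℝ) (η : ℝ) (y : E d) : E d := Classical.epsilon (IsProx Ω η y)

theorem isProx_prox {Ω : E d → ℝ} (hconv : ConvexOn ℝ Set.univ Ω) (hnonneg : ∀ w, 0 ≤ Ω w)
    {η : ℝ} (hη : 0 ≤ η) (y : E d) : IsProx Ω η y (prox Ω η y) :=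
  Classical.epsilon_spec (exists_isProx hconv hnonneg hη y)

theorem continuous_prox {Ω : E d → ℝ} (hconv : ConvexOn ℝ Set.univ Ω) (hnonneg : ∀ w, 0 ≤ Ω w)
    {η : ℝ} (hη : 0 ≤ η) : Continuous (prox Ω η) := by
  refine (LipschitzWith.of_dist_le_mul (K := 1) fun y y' => ?_).continuous
  rw [dist_eq_norm, dist_eq_norm, NNReal.coe_one, one_mul]
  exact (isProx_prox hconv hnonneg hη y).norm_sub_le hconv hη (isProx_prox hconv hnonneg hη y')

/-- Complete the square and use uniqueness. The iterates thereby become explicit functions of the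
data, which is what makes them measurable. -/
theorem eq_prox_of_step {Ω : E d → ℝ} (hconv : ConvexOn ℝ Set.univ Ω) (hnonneg : ∀ w, 0 ≤ Ω w)
    {η : ℝ} (hη : 0 ≤ η) {w g m : E d}
    (h : ∀ u, η * inner ℝ (m - w) g + η * Ω m + 1 / 2 * ‖m - w‖ ^ 2
      ≤ η * inner ℝ (u - w) g + η * Ω u + 1 / 2 * ‖u - w‖ ^ 2) :
    m = prox Ω η (w - η • g) := by
  have e : ∀ u : E d, ‖u - (w - η • g)‖ ^ 2 =
      ‖u - w‖ ^ 2 + 2 * (η * inner ℝ (u - w) g) + ‖η • g‖ ^ 2 := by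
    intro u
    have : u - (w - η • g) = (u - w) + η • g := by abel
    rw [this, norm_add_sq_real, inner_smul_right]
  have hm : IsProx Ω η (w - η • g) m := by
    intro u
    rw [e, e]
    linarith [h u]
  have := hm.norm_sub_le hconv hη (isProx_prox hconv hnonneg hη (w - η • g))
  rw [sub_self, norm_zero] at this
  exact sub_eq_zero.1 (norm_le_zero_iff.1 this)

/-- One step of the proximal gradient method, compared with an arbitrary point `v`. -/
theorem norm_prox_sub_sq_le {Ω : E d → ℝ} (hconv : ConvexOn ℝ Set.univ Ω)
    (hnonneg : ∀ w, 0 ≤ Ω w) {η : ℝ} (hη : 0 ≤ η) (w g v : E d) {G : E d}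
    (hG : IsSubgradient Ω w G) :
    ‖prox Ω η (w - η • g) - v‖ ^ 2 ≤
      ‖w - v‖ ^ 2 + 2 * η * (inner ℝ (v - w) g + Ω v - Ω w) + 2 * η ^ 2 * (‖g‖ ^ 2 + ‖G‖ ^ 2) := by
  set m := prox Ω η (w - η • g)
  have h1 := (isProx_prox hconv hnonneg hη (w - η • g)).three_point hconv hη v
  change η * Ω m + 1 / 2 * ‖m - _‖ ^ 2 + 1 / 2 * ‖v - m‖ ^ 2 ≤ _ at h1
  have e : ∀ u : E d, ‖u - (w - η • g)‖ ^ 2 =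
      ‖u - w‖ ^ 2 + 2 * (η * inner ℝ (u - w) g) + ‖η • g‖ ^ 2 := by
    intro u
    have : u - (w - η • g) = (u - w) + η • g := by abel
    rw [this, norm_add_sq_real, inner_smul_right]
  rw [e, e] at h1
  have h2 := mul_le_mul_of_nonneg_left (hG m) hη
  -- The subgradient G has replaced Ω at the new point by Ω at w. Completing the square then removes
  -- the displacement m - w, at the price η² ‖g + G‖².
  have h3 : 0 ≤ ‖(m - w) + η • (g + G)‖ ^ 2 := by positivity
  rw [norm_add_sq_real, inner_smul_right, inner_add_right, norm_smul, mul_pow,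
    Real.norm_eq_abs, sq_abs] at h3
  have h4 : ‖g + G‖ ^ 2 ≤ 2 * (‖g‖ ^ 2 + ‖G‖ ^ 2) := by
    have := parallelogram_law_with_norm ℝ g G
    nlinarith [sq_nonneg ‖g - G‖]
  have h5 := mul_le_mul_of_nonneg_left h4 (sq_nonneg η)
  rw [norm_sub_rev m v, norm_sub_rev w v]
  linarith

/-! ### The loss -/

/-- The loss is quadratic in w, so the two sides differ exactly by its quadratic part evaluated at
w' - w, whose coefficients are nonnegative. -/
theorem loss_add_inner_le {p : ℝ} (h0 : 0 ≤ p) (h1 : p ≤ 1) (u v : E d) (z : Example d)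
    (w w' : E d) :
    loss p u v z w + inner ℝ (w' - w) (lossGrad p u v z w) ≤ loss p u v z w' := by
  have hp : 0 ≤ p * (1 - p) := mul_nonneg h0 (by linarith)
  have hA := mul_nonneg (mul_nonneg (sub_nonneg.2 h1) (sq_nonneg (inner ℝ (w' - w) (z.1 - u))))
    (show (0 : ℝ) ≤ if z.2 = 1 then 1 else 0 by split_ifs <;> norm_num)
  have hB := mul_nonneg (mul_nonneg h0 (sq_nonneg (inner ℝ (w' - w) (z.1 - v))))
    (show (0 : ℝ) ≤ if z.2 = -1 then 1 else 0 by split_ifs <;> norm_num)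
  have hC := mul_nonneg hp (sq_nonneg (inner ℝ (w' - w) (v - u)))
  unfold loss lossGrad
  simp only [inner_add_right, inner_smul_right]
  rw [inner_sub_left w' w (z.1 - u)] at *
  rw [inner_sub_left w' w (z.1 - v)] at *
  rw [inner_sub_left w' w (v - u)] at *
  linarith

theorem norm_lossGrad_le {p κ : ℝ} (h0 : 0 ≤ p) (h1 : p ≤ 1) (hκ : 1 ≤ κ) {u v : E d}
    {z : Example d} (hu : ‖u‖ ≤ κ) (hv : ‖v‖ ≤ κ) (hz : ‖z.1‖ ≤ κ) (w : E d) :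
    ‖lossGrad p u v z w‖ ≤ 24 * κ ^ 2 * (1 + ‖w‖) := by
  have hκ0 : 0 ≤ κ := by linarith
  have hd : ∀ a b : E d, ‖a‖ ≤ κ → ‖b‖ ≤ κ → ‖a - b‖ ≤ 2 * κ := fun a b ha hb => by
    linarith [norm_sub_le a b]
  have hi : ∀ c : ℝ, |c| ≤ 1 → ∀ a : E d, ‖a‖ ≤ 2 * κ →
      ‖(2 * c * inner ℝ w a) • a‖ ≤ 8 * κ ^ 2 * ‖w‖ := by
    intro c hc a ha
    rw [norm_smul, Real.norm_eq_abs, abs_mul, abs_mul, abs_two]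
    have := abs_real_inner_le_norm w a
    have hw := norm_nonneg w
    have ha' := norm_nonneg a
    calc 2 * |c| * |inner ℝ w a| * ‖a‖ ≤ 2 * 1 * (‖w‖ * (2 * κ)) * (2 * κ) := by
          gcongr
          exact this.trans (by gcongr)
      _ = _ := by ring
  have t1 := hi ((1 - p) * (if z.2 = 1 then 1 else 0))
    (by split_ifs <;> rw [abs_le] <;> constructor <;> linarith) _ (hd _ _ hz hu)
  have t2 := hi (p * (if z.2 = -1 then 1 else 0))
    (by split_ifs <;> rw [abs_le] <;> constructor <;> linarith) _ (hd _ _ hz hv)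
  have hpp : |p * (1 - p)| ≤ 1 := by
    rw [abs_le]; constructor <;> nlinarith
  have t4 := hi (p * (1 - p)) hpp _ (hd _ _ hv hu)
  have t3 : ‖(2 * p * (1 - p)) • (v - u)‖ ≤ 4 * κ ^ 2 := by
    rw [norm_smul, Real.norm_eq_abs, mul_assoc, abs_mul, abs_two]
    have := hd _ _ hv hu
    calc 2 * |p * (1 - p)| * ‖v - u‖ ≤ 2 * 1 * (2 * κ) := by gcongr
      _ ≤ 4 * κ ^ 2 := by nlinarith
  have e : lossGrad p u v z w =
      (2 * ((1 - p) * (if z.2 = 1 then 1 else 0)) * inner ℝ w (z.1 - u)) • (z.1 - u)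
      + (2 * (p * (if z.2 = -1 then 1 else 0)) * inner ℝ w (z.1 - v)) • (z.1 - v)
      + (2 * p * (1 - p)) • (v - u)
      + (2 * (p * (1 - p)) * inner ℝ w (v - u)) • (v - u) := by
    unfold lossGrad
    congr 2 <;> [(congr 2 <;> ring_nf); ring_nf]
  rw [e]
  refine (norm_add₄_le).trans ?_
  have := mul_nonneg (sq_nonneg κ) (norm_nonneg w)
  nlinarith [sq_nonneg κ]

/-- The loss is Lipschitz in the class probability and the class means. -/
theorem abs_loss_sub_loss_le {p p' κ : ℝ} (h0 : 0 ≤ p) (h1 : p ≤ 1) (h0' : 0 ≤ p') (h1' : p' ≤ 1)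
    (hκ : 1 ≤ κ) {u v u' v' : E d} {z : Example d} (hu : ‖u‖ ≤ κ) (hv : ‖v‖ ≤ κ)
    (hu' : ‖u'‖ ≤ κ) (hv' : ‖v'‖ ≤ κ) (hz : ‖z.1‖ ≤ κ) (w : E d) :
    |loss p u v z w - loss p' u' v' z w| ≤
      50 * κ ^ 2 * (1 + ‖w‖) ^ 2 * (|p - p'| + ‖u - u'‖ + ‖v - v'‖) := by
  -- R bounds every inner product of w with a vector of norm at most κ, and R ≥ 1 allows all lower
  -- powers of R to be absorbed into R².
  set R := κ * (1 + ‖w‖) with hR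
  have hw := norm_nonneg w
  have hR1 : 1 ≤ R := by nlinarith
  set B := |p - p'| + ‖u - u'‖ + ‖v - v'‖ with hB
  have hB0 : 0 ≤ B := by positivity
  have hb : ∀ a : E d, ‖a‖ ≤ κ → |inner ℝ w a| ≤ R := fun a ha =>
    (abs_real_inner_le_norm w a).trans (by rw [hR]; nlinarith)
  have hl : ∀ a a' : E d, ‖a - a'‖ ≤ B → |(inner ℝ w a - inner ℝ w a' : ℝ)| ≤ R * B :=
    fun a a' ha => by
      rw [← inner_sub_right]
      refine (abs_real_inner_le_norm w _).trans ?_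
      exact mul_le_mul (by nlinarith) ha (norm_nonneg _) (by linarith)
  have hpB : |p - p'| ≤ B := by rw [hB]; linarith [norm_nonneg (u - u'), norm_nonneg (v - v')]
  have huB : ‖u - u'‖ ≤ B := by rw [hB]; linarith [abs_nonneg (p - p'), norm_nonneg (v - v')]
  have hvB : ‖v - v'‖ ≤ B := by rw [hB]; linarith [norm_nonneg (u - u'), abs_nonneg (p - p')]
  have ha := hb _ hu
  have ha' := hb _ hu'
  have hc := hb _ hv
  have hc' := hb _ hv'
  have hx := hb _ hz
  have da := hl _ _ huB
  have dc := hl _ _ hvB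
  -- products of bounded Lipschitz quantities
  have mulL : ∀ {s s' t t' S T L M : ℝ}, |s| ≤ S → |t'| ≤ T → |s - s'| ≤ L → |t - t'| ≤ M →
      |s * t - s' * t'| ≤ S * M + L * T := by
    intro s s' t t' S T L M hs ht hL hM
    have : s * t - s' * t' = s * (t - t') + (s - s') * t' := by ring
    rw [this]
    refine (abs_add_le _ _).trans ?_
    rw [abs_mul, abs_mul]
    gcongr
    · exact (abs_nonneg _).trans hs
    · exact (abs_nonneg _).trans hL
  have sqb : ∀ {s S : ℝ}, |s| ≤ S → |s ^ 2| ≤ S ^ 2 := fun {s S} h => by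
    rw [abs_pow]; gcongr
  have sqL : ∀ {s t L : ℝ}, |s| ≤ 2 * R → |t| ≤ 2 * R → |s - t| ≤ L →
      |s ^ 2 - t ^ 2| ≤ 4 * R * L := by
    intro s t L hs ht hL
    have : s ^ 2 - t ^ 2 = (s - t) * (s + t) := by ring
    rw [this, abs_mul, mul_comm (4 * R)]
    refine mul_le_mul hL ((abs_add_le _ _).trans (by linarith)) (abs_nonneg _)
      ((abs_nonneg _).trans hL)
  have ind : ∀ y : ℤˣ, |(if z.2 = y then (1 : ℝ) else 0)| ≤ 1 := fun y => by
    split_ifs <;> norm_num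
  have hp1 : |p| ≤ 1 := abs_le.2 ⟨by linarith, h1⟩
  have hq1 : |1 - p| ≤ 1 := abs_le.2 ⟨by linarith, by linarith⟩
  have hp1' : |p'| ≤ 1 := abs_le.2 ⟨by linarith, h1'⟩
  have hq1' : |1 - p'| ≤ 1 := abs_le.2 ⟨by linarith, by linarith⟩
  have hqB : |(1 - p) - (1 - p')| ≤ B := by
    rw [show (1 - p) - (1 - p') = -(p - p') by ring, abs_neg]; exact hpB
  have hpq : |p * (1 - p)| ≤ 1 := by rw [abs_mul]; exact mul_le_one₀ hp1 (abs_nonneg _) hq1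
  have hpqB : |p * (1 - p) - p' * (1 - p')| ≤ 2 * B := by
    have := mulL hp1 hq1' hpB hqB
    linarith
  have bd : ∀ {s t : ℝ}, |s| ≤ R → |t| ≤ R → |s - t| ≤ 2 * R := fun hs ht =>
    (abs_sub _ _).trans (by linarith)
  have T1 := mulL hq1 (sqb (bd hx ha')) hqB
    (sqL (bd hx ha) (bd hx ha') (L := R * B) (by
      rw [show ∀ x a b : ℝ, x - a - (x - b) = -(a - b) by intros; ring, abs_neg]; exact da))
  have T2 := mulL hp1 (sqb (bd hx hc')) hpB
    (sqL (bd hx hc) (bd hx hc') (L := R * B) (by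
      rw [show ∀ x a b : ℝ, x - a - (x - b) = -(a - b) by intros; ring, abs_neg]; exact dc))
  have dd : |(inner ℝ w v - inner ℝ w u : ℝ) - (inner ℝ w v' - inner ℝ w u')| ≤ 2 * (R * B) := by
    rw [show ∀ a b c e : ℝ, a - b - (c - e) = (a - c) - (b - e) by intros; ring]
    exact (abs_sub _ _).trans (by linarith)
  have T3 := mulL hpq (bd hc' ha') hpqB dd
  have T4 := mulL hpq (sqb (bd hc' ha')) hpqB (sqL (bd hc ha) (bd hc' ha') dd)
  have indm : ∀ (s : ℝ) (y : ℤˣ), |s * (if z.2 = y then (1 : ℝ) else 0)| ≤ |s| := fun s y => by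
    rw [abs_mul]; exact mul_le_of_le_one_right (abs_nonneg _) (ind y)
  have e : loss p u v z w - loss p' u' v' z w =
      ((1 - p) * (inner ℝ w z.1 - inner ℝ w u) ^ 2
        - (1 - p') * (inner ℝ w z.1 - inner ℝ w u') ^ 2) * (if z.2 = 1 then (1 : ℝ) else 0)
      + (p * (inner ℝ w z.1 - inner ℝ w v) ^ 2
        - p' * (inner ℝ w z.1 - inner ℝ w v') ^ 2) * (if z.2 = -1 then (1 : ℝ) else 0)
      + 2 * (p * (1 - p) * (inner ℝ w v - inner ℝ w u)
        - p' * (1 - p') * (inner ℝ w v' - inner ℝ w u'))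
      + (p * (1 - p) * (inner ℝ w v - inner ℝ w u) ^ 2
        - p' * (1 - p') * (inner ℝ w v' - inner ℝ w u') ^ 2)
      + (p * (1 - p) - p' * (1 - p')) := by
    unfold loss
    simp only [inner_sub_right]
    ring
  rw [e]
  have I1 := (indm _ 1).trans T1
  have I2 := (indm _ (-1)).trans T2
  have RB : R * B ≤ R ^ 2 * B :=
    mul_le_mul_of_nonneg_right (le_self_pow₀ hR1 two_ne_zero) hB0
  have BB : B ≤ R ^ 2 * B := le_mul_of_one_le_left hB0 (one_le_pow₀ hR1)
  have fin : 50 * κ ^ 2 * (1 + ‖w‖) ^ 2 * B = 50 * (R ^ 2 * B) := by rw [hR]; ring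
  rw [fin]
  -- The five differences cost at most 8, 8, 12, 16 and 2 times R² B, 46 in all.
  clear_value R B
  rw [abs_le] at I1 I2 T3 T4 hpqB ⊢
  constructor <;> linarith

theorem convexOn_loss {p : ℝ} (h0 : 0 ≤ p) (h1 : p ≤ 1) (u v : E d) (z : Example d) :
    ConvexOn ℝ Set.univ (loss p u v z) := by
  refine ⟨convex_univ, fun a _ b _ s t hs ht hst => ?_⟩
  set c := s • a + t • b
  have ha := mul_le_mul_of_nonneg_left (loss_add_inner_le h0 h1 u v z c a) hs
  have hb := mul_le_mul_of_nonneg_left (loss_add_inner_le h0 h1 u v z c b) ht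
  have e : s * inner ℝ (a - c) (lossGrad p u v z c) + t * inner ℝ (b - c) (lossGrad p u v z c)
      = 0 := by
    rw [← real_inner_smul_left, ← real_inner_smul_left, ← inner_add_left]
    have : s • (a - c) + t • (b - c) = 0 := by
      have : s • (a - c) + t • (b - c) = (s • a + t • b) - (s + t) • c := by module
      rw [this, hst, one_smul, sub_self]
    rw [this, inner_zero_left]
  simp only [smul_eq_mul]
  have : (s + t) * loss p u v z c = loss p u v z c := by rw [hst, one_mul]
  linarith

/-! ### The population loss -/

instance : MeasurableSingletonClass ℤˣ :=
  ⟨fun y => ⟨{(y : ℤ)}, MeasurableSet.singleton _, by ext; simp [Units.ext_iff]⟩⟩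

theorem measurableSet_label (y : ℤˣ) : MeasurableSet {z : Example d | z.2 = y} :=
  measurable_snd (measurableSet_singleton y)

theorem measurable_label_ite (y : ℤˣ) :
    Measurable fun z : Example d => if z.2 = y then (1 : ℝ) else 0 :=
  Measurable.ite (measurableSet_label y) measurable_const measurable_const

/-- The mean input `E[x | y]` of the class with label `y`. -/
def classMean (ρ : Measure (Example d)) (y : ℤˣ) : E d :=
  (ρ.real {z | z.2 = y})⁻¹ • ∫ z in {z | z.2 = y}, z.1 ∂ρ

theorem real_neg_label (ρ : Measure (Example d)) [IsProbabilityMeasure ρ] :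
    ρ.real {z | z.2 = -1} = 1 - posProb ρ := by
  have : {z : Example d | z.2 = -1} = {z | z.2 = 1}ᶜ := by
    ext z
    rcases Int.units_eq_one_or z.2 with h | h <;> simp [h]
  rw [this, probReal_compl_eq_one_sub (measurableSet_label 1), posProb]

/-- `f` is integrable with integral `a`. -/
def IntegralEq {α : Type*} [MeasurableSpace α] (μ : Measure α) (f : α → ℝ) (a : ℝ) : Prop :=
  Integrable f μ ∧ ∫ x, f x ∂μ = a

namespace IntegralEq

variable {α : Type*} [MeasurableSpace α] {μ : Measure α} {f g : α → ℝ} {a b : ℝ}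

theorem of_integrable (hf : Integrable f μ) : IntegralEq μ f (∫ x, f x ∂μ) := ⟨hf, rfl⟩

theorem add (hf : IntegralEq μ f a) (hg : IntegralEq μ g b) :
    IntegralEq μ (fun x => f x + g x) (a + b) :=
  ⟨hf.1.add hg.1, by rw [integral_add hf.1 hg.1, hf.2, hg.2]⟩

theorem sub (hf : IntegralEq μ f a) (hg : IntegralEq μ g b) :
    IntegralEq μ (fun x => f x - g x) (a - b) :=
  ⟨hf.1.sub hg.1, by rw [integral_sub hf.1 hg.1, hf.2, hg.2]⟩

theorem const_mul (c : ℝ) (hf : IntegralEq μ f a) : IntegralEq μ (fun x => c * f x) (c * a) :=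
  ⟨hf.1.const_mul c, by rw [integral_const_mul, hf.2]⟩

theorem const [IsFiniteMeasure μ] (c : ℝ) : IntegralEq μ (fun _ => c) (μ.real Set.univ * c) :=
  ⟨integrable_const c, by simp⟩

theorem mul_prod {β : Type*} [MeasurableSpace β] {ν : Measure β} [SFinite μ] [SFinite ν]
    {g : β → ℝ} (hf : IntegralEq μ f a) (hg : IntegralEq ν g b) :
    IntegralEq (μ.prod ν) (fun q => f q.1 * g q.2) (a * b) :=
  ⟨hf.1.mul_prod hg.1, by rw [integral_prod_mul f g, hf.2, hg.2]⟩

theorem indicator {s : Set α} (hs : MeasurableSet s) (hf : Integrable f μ) :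
    IntegralEq μ (s.indicator f) (∫ x in s, f x ∂μ) :=
  ⟨hf.indicator hs, integral_indicator hs⟩

end IntegralEq

theorem norm_classMean_le {ρ : Measure (Example d)} [IsProbabilityMeasure ρ] {κ : ℝ}
    (hκ : 0 ≤ κ) (hb : ∀ᵐ z ∂ρ, ‖z.1‖ ≤ κ) (y : ℤˣ) : ‖classMean ρ y‖ ≤ κ := by
  have h := norm_setIntegral_le_of_norm_le_const_ae (μ := ρ) (s := {z : Example d | z.2 = y})
    (f := fun z => z.1) (C := κ) (measure_lt_top _ _) (ae_restrict_of_ae hb)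
  rw [classMean, norm_smul, norm_inv, Real.norm_of_nonneg measureReal_nonneg]
  rcases (measureReal_nonneg (μ := ρ) (s := {z : Example d | z.2 = y})).eq_or_lt with h0 | h0
  · rw [← h0]; simpa using hκ
  · rw [inv_mul_le_iff₀ h0, mul_comm]
    exact h

theorem integrable_loss {ρ : Measure (Example d)} [IsProbabilityMeasure ρ] {κ : ℝ}
    (hb : ∀ᵐ z ∂ρ, ‖z.1‖ ≤ κ) (p : ℝ) (u v w : E d) :
    Integrable (fun z => loss p u v z w) ρ := by
  have hc : ∀ y : ℤˣ, ∀ z : Example d, ‖if z.2 = y then (1 : ℝ) else 0‖ ≤ 1 := fun y z => by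
    split_ifs <;> simp
  have hsq : ∀ a : E d, Integrable (fun z : Example d => (inner ℝ w (z.1 - a)) ^ 2) ρ := by
    intro a
    refine Integrable.of_bound (C := (‖w‖ * (κ + ‖a‖)) ^ 2)
      (Measurable.aestronglyMeasurable (by fun_prop)) (hb.mono fun z hz => ?_)
    rw [norm_pow]
    gcongr
    refine (abs_real_inner_le_norm _ _).trans ?_
    gcongr
    exact (norm_sub_le _ _).trans (by gcongr)
  unfold loss
  have i1 := ((hsq u).const_mul (1 - p)).mul_bdd (c := 1)
    (measurable_label_ite 1).aestronglyMeasurable (Filter.Eventually.of_forall (hc 1))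
  have i2 := ((hsq v).const_mul p).mul_bdd (c := 1)
    (measurable_label_ite (-1)).aestronglyMeasurable (Filter.Eventually.of_forall (hc (-1)))
  exact (((i1.add i2).add (integrable_const _)).add (integrable_const _)).add (integrable_const _)

/-- Both sides depend only on p and on the first two moments of ⟨w, x⟩ in each class. Independence
turns the cross term of the pairwise square into a product of class means, so the pairwise risk can
be written as an expectation over a single example. -/
theorem integral_loss_eq_aucRisk {ρ : Measure (Example d)} [IsProbabilityMeasure ρ] {κ : ℝ}
    (hb : ∀ᵐ z ∂ρ, ‖z.1‖ ≤ κ) (hp : 0 < posProb ρ) (hp' : posProb ρ < 1) (w : E d) :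
    ∫ z, loss (posProb ρ) (classMean ρ 1) (classMean ρ (-1)) z w ∂ρ = aucRisk ρ w := by
  set p := posProb ρ with hpdef
  set Sp : Set (Example d) := {z | z.2 = 1} with hSp
  set Sn : Set (Example d) := {z | z.2 = -1} with hSn
  have mSp : MeasurableSet Sp := measurableSet_label 1
  have mSn : MeasurableSet Sn := measurableSet_label (-1)
  have rp : ρ.real Sp = p := rfl
  have rn : ρ.real Sn = 1 - p := real_neg_label ρ
  have ix : Integrable (fun z : Example d => z.1) ρ :=
    Integrable.of_bound measurable_fst.aestronglyMeasurable _ hb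
  have ia : Integrable (fun z : Example d => (inner ℝ w z.1 : ℝ)) ρ := ix.const_inner w
  have ia2 : Integrable (fun z : Example d => (inner ℝ w z.1 : ℝ) ^ 2) ρ := by
    refine Integrable.of_bound (C := (‖w‖ * κ) ^ 2)
      (Measurable.aestronglyMeasurable (by fun_prop)) (hb.mono fun z hz => ?_)
    rw [norm_pow]
    gcongr
    exact (abs_real_inner_le_norm _ _).trans (by gcongr)
  -- first and second moments of the two classes
  set mp := ∫ z in Sp, (inner ℝ w z.1 : ℝ) ∂ρ with hmp
  set mn := ∫ z in Sn, (inner ℝ w z.1 : ℝ) ∂ρ with hmn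
  set qp := ∫ z in Sp, (inner ℝ w z.1 : ℝ) ^ 2 ∂ρ with hqp
  set qn := ∫ z in Sn, (inner ℝ w z.1 : ℝ) ^ 2 ∂ρ with hqn
  have eu : inner ℝ w (classMean ρ 1) = p⁻¹ * mp := by
    rw [classMean, inner_smul_right, ← integral_inner ix.integrableOn]
    rfl
  have ev : inner ℝ w (classMean ρ (-1)) = (1 - p)⁻¹ * mn := by
    rw [classMean, inner_smul_right, ← integral_inner ix.integrableOn]
    simp only [← hSn, rn]
    rfl
  have e : ∀ (a : E d) (z : Example d), (inner ℝ w (z.1 - a)) ^ 2 =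
      (inner ℝ w z.1 : ℝ) ^ 2 - 2 * inner ℝ w a * inner ℝ w z.1 + (inner ℝ w a) ^ 2 := by
    intro a z; rw [inner_sub_right]; ring
  have quad : ∀ (S : Set (Example d)) (a : E d),
      ∫ z in S, (inner ℝ w (z.1 - a)) ^ 2 ∂ρ = ∫ z in S, (inner ℝ w z.1 : ℝ) ^ 2 ∂ρ
        - 2 * inner ℝ w a * ∫ z in S, (inner ℝ w z.1 : ℝ) ∂ρ + ρ.real S * (inner ℝ w a) ^ 2 := by
    intro S a
    simp_rw [e]
    rw [(((IntegralEq.of_integrable ia2.integrableOn).sub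
      ((IntegralEq.of_integrable ia.integrableOn).const_mul _)).add (IntegralEq.const _)).2]
    simp
  have isq : ∀ a : E d, Integrable (fun z : Example d => (inner ℝ w (z.1 - a)) ^ 2) ρ := by
    intro a
    simp_rw [e]
    exact (ia2.sub (ia.const_mul _)).add (integrable_const _)
  have hL : ∫ z, loss p (classMean ρ 1) (classMean ρ (-1)) z w ∂ρ =
      (1 - p) * ∫ z in Sp, (inner ℝ w (z.1 - classMean ρ 1)) ^ 2 ∂ρ
      + p * ∫ z in Sn, (inner ℝ w (z.1 - classMean ρ (-1))) ^ 2 ∂ρ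
      + 2 * p * (1 - p) * inner ℝ w (classMean ρ (-1) - classMean ρ 1)
      + p * (1 - p) * (inner ℝ w (classMean ρ (-1) - classMean ρ 1)) ^ 2 + p * (1 - p) := by
    have e : ∀ z : Example d, loss p (classMean ρ 1) (classMean ρ (-1)) z w =
        (1 - p) * Sp.indicator (fun z => (inner ℝ w (z.1 - classMean ρ 1)) ^ 2) z
        + p * Sn.indicator (fun z => (inner ℝ w (z.1 - classMean ρ (-1))) ^ 2) z
        + (2 * p * (1 - p) * inner ℝ w (classMean ρ (-1) - classMean ρ 1)
      + p * (1 - p) * (inner ℝ w (classMean ρ (-1) - classMean ρ 1)) ^ 2 + p * (1 - p)) := by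
      intro z
      simp only [loss, Set.indicator_apply, hSp, hSn, Set.mem_ofPred_eq]
      split_ifs <;> ring
    simp_rw [e]
    rw [((((IntegralEq.indicator mSp (isq _)).const_mul _).add
      ((IntegralEq.indicator mSn (isq _)).const_mul _)).add (IntegralEq.const _)).2]
    simp [add_assoc]
  have hS : {q : Example d × Example d | q.1.2 = 1 ∧ q.2.2 = -1} = Sp ×ˢ Sn := rfl
  -- The prefactor p (1 - p) is the mass of the conditioning event, so it cancels the normalization
  -- of the conditional measure.
  have hR : aucRisk ρ w =
      ∫ q, (1 - inner ℝ w (q.1.1 - q.2.1)) ^ 2 ∂((ρ.restrict Sp).prod (ρ.restrict Sn)) := by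
    have hne : p * (1 - p) ≠ 0 := (mul_pos hp (sub_pos.2 hp')).ne'
    rw [aucRisk, hS, ProbabilityTheory.cond, integral_smul_measure, Measure.prod_restrict, Measure.prod_prod,
      ENNReal.toReal_inv, ENNReal.toReal_mul]
    change p * (1 - p) * ((ρ.real Sp * ρ.real Sn)⁻¹ * _) = _
    rw [rp, rn, mul_inv_cancel_left₀ hne]
  have ja := ia.mono_measure (Measure.restrict_le_self (s := Sp))
  have ja' := ia.mono_measure (Measure.restrict_le_self (s := Sn))
  have ja2 := ia2.mono_measure (Measure.restrict_le_self (s := Sp))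
  have ja2' := ia2.mono_measure (Measure.restrict_le_self (s := Sn))
  have hR' : ∫ q, (1 - inner ℝ w (q.1.1 - q.2.1)) ^ 2 ∂((ρ.restrict Sp).prod (ρ.restrict Sn)) =
      p * (1 - p) + qp * (1 - p) + p * qn - 2 * (mp * (1 - p)) + 2 * (p * mn)
        - 2 * (mp * mn) := by
    have e : ∀ q : Example d × Example d, (1 - inner ℝ w (q.1.1 - q.2.1) : ℝ) ^ 2 =
        1 * 1 + (inner ℝ w q.1.1) ^ 2 * 1 + 1 * (inner ℝ w q.2.1) ^ 2
        - 2 * (inner ℝ w q.1.1 * 1) + 2 * (1 * inner ℝ w q.2.1)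
        - 2 * (inner ℝ w q.1.1 * inner ℝ w q.2.1) := by
      intro q; rw [inner_sub_right]; ring
    simp_rw [e]
    have c1 : IntegralEq (ρ.restrict Sp) (fun _ : Example d => (1 : ℝ)) p :=
      ⟨integrable_const _, by simp [rp]⟩
    have c2 : IntegralEq (ρ.restrict Sn) (fun _ : Example d => (1 : ℝ)) (1 - p) :=
      ⟨integrable_const _, by simp [rn]⟩
    have a1 := IntegralEq.of_integrable ja
    have a2 := IntegralEq.of_integrable ja'
    have b1 := IntegralEq.of_integrable ja2
    have b2 := IntegralEq.of_integrable ja2'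
    rw [((((((c1.mul_prod c2).add (b1.mul_prod c2)).add (c1.mul_prod b2)).sub
      ((a1.mul_prod c2).const_mul 2)).add ((c1.mul_prod a2).const_mul 2)).sub
      ((a1.mul_prod a2).const_mul 2)).2]
  rw [hL, hR, hR', quad, quad, inner_sub_right, eu, ev, rp, rn, ← hmp, ← hmn, ← hqp, ← hqn]
  have h1 : p ≠ 0 := hp.ne'
  have h2 : 1 - p ≠ 0 := (sub_pos.2 hp').ne'
  field_simp
  ring

theorem convexOn_aucRisk {ρ : Measure (Example d)} [IsProbabilityMeasure ρ] {κ : ℝ}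
    (hb : ∀ᵐ z ∂ρ, ‖z.1‖ ≤ κ) (hp : 0 < posProb ρ) (hp' : posProb ρ < 1) :
    ConvexOn ℝ Set.univ (aucRisk ρ) := by
  refine ⟨convex_univ, fun a _ b _ s t hs ht hst => ?_⟩
  simp only [← integral_loss_eq_aucRisk hb hp hp', smul_eq_mul]
  rw [← integral_const_mul, ← integral_const_mul,
    ← integral_add ((integrable_loss hb _ _ _ _).const_mul _)
      ((integrable_loss hb _ _ _ _).const_mul _)]
  refine integral_mono (integrable_loss hb _ _ _ _)
    (((integrable_loss hb _ _ _ _).const_mul _).add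
      ((integrable_loss hb _ _ _ _).const_mul _)) fun z => ?_
  exact (convexOn_loss hp.le hp'.le _ _ z).2 (Set.mem_univ a) (Set.mem_univ b) hs ht hst

theorem aucRisk_nonneg (ρ : Measure (Example d)) [IsProbabilityMeasure ρ] (w : E d) :
    0 ≤ aucRisk ρ w :=
  mul_nonneg (mul_nonneg measureReal_nonneg (sub_nonneg.2 measureReal_le_one))
    (integral_nonneg fun _ => sq_nonneg _)

/-! ### Expected progress of one step -/

/-- `K` controls the expected squared distance to `v₀` after one proximal step with class
probability `p` and class means `u`, `v` in place of the true ones. -/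
def IsStepConstant (ρ : Measure (Example d)) (Ω : E d → ℝ) (κ A₁ : ℝ) (v₀ : E d) (K : ℝ) : Prop :=
  ∀ η : ℝ, 0 ≤ η → 2 * A₁ * η ≤ 1 → ∀ (p : ℝ) (u v : E d), 0 ≤ p → p ≤ 1 →
    ‖u‖ ≤ κ → ‖v‖ ≤ κ → ∀ w : E d,
    ∫⁻ z, ENNReal.ofReal (1 + ‖prox Ω η (w - η • lossGrad p u v z w) - v₀‖ ^ 2) ∂ρ
      + ENNReal.ofReal (η * (objective ρ Ω w - objective ρ Ω v₀))
    ≤ ENNReal.ofReal ((1 + K * (η * (|p - posProb ρ| + ‖u - classMean ρ 1‖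
        + ‖v - classMean ρ (-1)‖) + η ^ 2)) * (1 + ‖w - v₀‖ ^ 2))

/-- Convexity bounds the gradient term by a loss difference, whose mean is the risk difference up to
a bias of order b. All error terms grow at most like (1 + ‖w‖)², apart from the Ω(w) coming from the
subgradient, which half of the expected decrease absorbs. The summand 1 next to ‖w - v₀‖² makes the
resulting bound purely multiplicative. -/
theorem exists_isStepConstant {ρ : Measure (Example d)} [IsProbabilityMeasure ρ] {κ : ℝ} (hκ : 1 ≤ κ)
    (hb : ∀ᵐ z ∂ρ, ‖z.1‖ ≤ κ) (hp : 0 < posProb ρ) (hp' : posProb ρ < 1)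
    {Ω : E d → ℝ} (hconv : ConvexOn ℝ Set.univ Ω) (hnonneg : ∀ w, 0 ≤ Ω w)
    {A₁ A₂ : ℝ} (hA₁ : 0 ≤ A₁) (hA₂ : 0 ≤ A₂) (hself : SelfBounding Ω A₁ A₂)
    {v₀ : E d} (hv₀ : v₀ ∈ minimizers (objective ρ Ω)) :
    ∃ K : ℝ, 0 ≤ K ∧ IsStepConstant ρ Ω κ A₁ v₀ K := by
  set N := 2 * (1 + ‖v₀‖) ^ 2 with hN
  have hφ₀ : 0 ≤ objective ρ Ω v₀ := add_nonneg (aucRisk_nonneg ρ v₀) (hnonneg v₀)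
  have hN0 : 0 ≤ N := by positivity
  -- The first term is the bias, 2 · (50 + 50) for the two points v₀ and w; the second is 2 · 24²
  -- from the squared gradient; the last two come from the subgradient bound.
  refine ⟨200 * κ ^ 2 * N + 1152 * κ ^ 4 * N + 2 * A₁ * objective ρ Ω v₀ + 2 * A₂, by positivity,
    fun η hη hAη p u v h0 h1 hu hv w => ?_⟩
  obtain ⟨G, hG, hG2⟩ := hself w
  set b := |p - posProb ρ| + ‖u - classMean ρ 1‖ + ‖v - classMean ρ (-1)‖ with hbdef
  have hb0 : 0 ≤ b := by positivity
  set D := ‖w - v₀‖ ^ 2 with hD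
  have hD0 : 0 ≤ D := by positivity
  have hNw : (1 + ‖w‖) ^ 2 ≤ N * (1 + D) := by
    have h : ‖w‖ ≤ ‖v₀‖ + ‖w - v₀‖ := by
      simpa using norm_add_le v₀ (w - v₀)
    have h2 : (1 + ‖w‖) ^ 2 ≤ ((1 + ‖v₀‖) + ‖w - v₀‖) ^ 2 :=
      pow_le_pow_left₀ (by positivity) (by linarith) 2
    have h3 : (1 : ℝ) ≤ (1 + ‖v₀‖) ^ 2 := one_le_pow₀ (by simp)
    have h4 : D ≤ (1 + ‖v₀‖) ^ 2 * D := le_mul_of_one_le_left hD0 h3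
    nlinarith [sq_nonneg ((1 + ‖v₀‖) - ‖w - v₀‖)]
  have hNv : (1 + ‖v₀‖) ^ 2 ≤ N * (1 + D) := by
    have : 0 ≤ (1 + ‖v₀‖) ^ 2 := by positivity
    nlinarith [mul_nonneg this hD0]
  -- the loss is close to the population risk
  have hclose : ∀ a : E d, |∫ z, loss p u v z a ∂ρ - aucRisk ρ a| ≤
      50 * κ ^ 2 * (1 + ‖a‖) ^ 2 * b := by
    intro a
    rw [← integral_loss_eq_aucRisk hb hp hp',
      ← integral_sub (integrable_loss hb _ _ _ _) (integrable_loss hb _ _ _ _), ← Real.norm_eq_abs]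
    refine (norm_integral_le_of_norm_le_const (hb.mono fun z hz => ?_)).trans_eq (by simp; rfl)
    exact abs_loss_sub_loss_le h0 h1 hp.le hp'.le hκ hu hv
      (norm_classMean_le (by linarith) hb _) (norm_classMean_le (by linarith) hb _) hz a
  set H : Example d → ℝ := fun z => 1 + D + 2 * η * (loss p u v z v₀ - loss p u v z w
    + (Ω v₀ - Ω w)) + 2 * η ^ 2 * (576 * κ ^ 4 * (1 + ‖w‖) ^ 2 + (A₁ * Ω w + A₂)) with hH
  have hpath : ∀ᵐ z ∂ρ, 1 + ‖prox Ω η (w - η • lossGrad p u v z w) - v₀‖ ^ 2 ≤ H z := by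
    filter_upwards [hb] with z hz
    have s1 := norm_prox_sub_sq_le hconv hnonneg hη w (lossGrad p u v z w) v₀ hG
    have s2 := loss_add_inner_le h0 h1 u v z w v₀
    have s3 : ‖lossGrad p u v z w‖ ^ 2 ≤ 576 * κ ^ 4 * (1 + ‖w‖) ^ 2 := by
      calc _ ≤ (24 * κ ^ 2 * (1 + ‖w‖)) ^ 2 := by
            gcongr; exact norm_lossGrad_le h0 h1 hκ hu hv hz w
        _ = _ := by ring
    have s4 : 2 * η * (inner ℝ (v₀ - w) (lossGrad p u v z w) + Ω v₀ - Ω w) ≤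
        2 * η * (loss p u v z v₀ - loss p u v z w + (Ω v₀ - Ω w)) :=
      mul_le_mul_of_nonneg_left (by linarith) (by linarith)
    have s5 := mul_le_mul_of_nonneg_left (add_le_add s3 hG2) (show 0 ≤ 2 * η ^ 2 by positivity)
    simp only [hH]
    linarith
  have iv := integrable_loss hb p u v v₀
  have iw := integrable_loss hb p u v w
  have hint : IntegralEq ρ H (1 + D + 2 * η * (∫ z, loss p u v z v₀ ∂ρ - ∫ z, loss p u v z w ∂ρ
      + (Ω v₀ - Ω w)) + 2 * η ^ 2 * (576 * κ ^ 4 * (1 + ‖w‖) ^ 2 + (A₁ * Ω w + A₂))) := by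
    have := ((IntegralEq.const (μ := ρ) (1 + D)).add
      ((((IntegralEq.of_integrable iv).sub (IntegralEq.of_integrable iw)).add
        (IntegralEq.const (Ω v₀ - Ω w))).const_mul (2 * η))).add
      (IntegralEq.const (2 * η ^ 2 * (576 * κ ^ 4 * (1 + ‖w‖) ^ 2 + (A₁ * Ω w + A₂))))
    simpa only [probReal_univ, one_mul] using this
  have hgap : 0 ≤ objective ρ Ω w - objective ρ Ω v₀ := sub_nonneg.2 (hv₀ w)
  have hfin : (∫ z, H z ∂ρ) + η * (objective ρ Ω w - objective ρ Ω v₀) ≤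
      (1 + (200 * κ ^ 2 * N + 1152 * κ ^ 4 * N + 2 * A₁ * objective ρ Ω v₀ + 2 * A₂)
        * (η * b + η ^ 2)) * (1 + D) := by
    rw [hint.2]
    have c1 := (abs_le.1 (hclose v₀)).2
    have c2 := (abs_le.1 (hclose w)).1
    have c3 : 50 * κ ^ 2 * (1 + ‖v₀‖) ^ 2 * b ≤ 50 * κ ^ 2 * (N * (1 + D)) * b := by gcongr
    have c4 : 50 * κ ^ 2 * (1 + ‖w‖) ^ 2 * b ≤ 50 * κ ^ 2 * (N * (1 + D)) * b := by gcongr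
    have c5 : 576 * κ ^ 4 * (1 + ‖w‖) ^ 2 ≤ 576 * κ ^ 4 * (N * (1 + D)) := by gcongr
    have c6 : Ω w ≤ objective ρ Ω w := le_add_of_nonneg_left (aucRisk_nonneg ρ w)
    set gap := objective ρ Ω w - objective ρ Ω v₀ with hgapdef
    have c7 : 2 * η * (∫ z, loss p u v z v₀ ∂ρ - ∫ z, loss p u v z w ∂ρ + (Ω v₀ - Ω w)) ≤
        2 * η * (100 * κ ^ 2 * (N * (1 + D)) * b - gap) := by
      refine mul_le_mul_of_nonneg_left ?_ (by linarith)
      simp only [hgapdef, objective]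
      linarith
    have c8 : 2 * η ^ 2 * (576 * κ ^ 4 * (1 + ‖w‖) ^ 2 + (A₁ * Ω w + A₂)) ≤
        2 * η ^ 2 * (576 * κ ^ 4 * (N * (1 + D)) + A₁ * objective ρ Ω w + A₂) := by
      refine mul_le_mul_of_nonneg_left ?_ (by positivity)
      linarith [mul_le_mul_of_nonneg_left c6 hA₁]
    -- Split φ(w) into the gap and φ(v₀). As 2 A₁ η ≤ 1, the gap part costs at most η times the gap,
    -- and one of the two available copies survives.
    have c9 : 2 * η ^ 2 * (A₁ * objective ρ Ω w) ≤
        η * gap + 2 * η ^ 2 * (A₁ * objective ρ Ω v₀) := by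
      have := mul_le_mul_of_nonneg_right hAη (mul_nonneg hη hgap)
      have e : objective ρ Ω w = gap + objective ρ Ω v₀ := by rw [hgapdef]; ring
      rw [e]
      linarith
    have d1 : 0 ≤ η ^ 2 * D * (2 * A₁ * objective ρ Ω v₀ + 2 * A₂) := by positivity
    have d2 : 0 ≤ η * b * (1 + D) * (1152 * κ ^ 4 * N + 2 * A₁ * objective ρ Ω v₀ + 2 * A₂) := by
      positivity
    have d3 : 0 ≤ η ^ 2 * (1 + D) * (200 * κ ^ 2 * N) := by positivity
    linarith
  have hH0 : 0 ≤ᵐ[ρ] H := hpath.mono fun z hz => le_trans (by positivity) hz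
  calc _ ≤ ∫⁻ z, ENNReal.ofReal (H z) ∂ρ
        + ENNReal.ofReal (η * (objective ρ Ω w - objective ρ Ω v₀)) := by
        exact add_le_add_left
          (lintegral_mono_ae (hpath.mono fun z hz => ENNReal.ofReal_le_ofReal hz)) _
    _ = ENNReal.ofReal ((∫ z, H z ∂ρ) + η * (objective ρ Ω w - objective ρ Ω v₀)) := by
        rw [← ofReal_integral_eq_lintegral_ofReal hint.1 hH0,
          ENNReal.ofReal_add (integral_nonneg_of_ae hH0) (mul_nonneg hη hgap)]
    _ ≤ _ := ENNReal.ofReal_le_ofReal hfin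

/-! ### Empirical averages -/

theorem IsSample.ae_bound {S : Type*} [MeasurableSpace S] {P : Measure S} {ρ : Measure (Example d)}
    {z : ℕ → S → Example d} (hz : IsSample P ρ z) {q : Example d → Prop} (hq : ∀ᵐ x ∂ρ, q x) :
    ∀ᵐ s ∂P, ∀ t, q (z t s) := by
  rw [ae_all_iff]
  intro t
  rw [← hz.law t] at hq
  exact ae_of_ae_map (hz.measurable t).aemeasurable hq

/-- By pairwise independence the sum of the first t values has variance at most t c²; the passage
from second to first moment is a pointwise inequality. -/
theorem IsSample.lintegral_abs_mean_sub_le {S : Type*} [MeasurableSpace S] {P : Measure S}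
    [IsProbabilityMeasure P] {ρ : Measure (Example d)} {z : ℕ → S → Example d}
    (hz : IsSample P ρ z) {h : Example d → ℝ} (hm : Measurable h) {c : ℝ} (hc : 0 < c)
    (hb : ∀ᵐ x ∂ρ, |h x| ≤ c) {t : ℕ} (ht : 1 ≤ t) :
    ∫⁻ s, ENNReal.ofReal |(∑ i ∈ Finset.range t, h (z i s)) / t - ∫ x, h x ∂ρ| ∂P ≤
      ENNReal.ofReal (c / √t) := by
  have ht0 : (0 : ℝ) < t := by exact_mod_cast ht
  set m := ∫ x, h x ∂ρ with hmdef
  set X : ℕ → S → ℝ := fun i s => h (z i s) with hX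
  have hXm : ∀ i, Measurable (X i) := fun i => hm.comp (hz.measurable i)
  have hae := hz.ae_bound hb
  have hL : ∀ i, MemLp (X i) 2 P := fun i =>
    MemLp.of_bound (hXm i).aestronglyMeasurable c (hae.mono fun s hs => hs i)
  have hE : ∀ i, ∫ s, X i s ∂P = m := by
    intro i
    rw [hmdef, ← hz.law i, integral_map (hz.measurable i).aemeasurable hm.aestronglyMeasurable]
  have hvar : Var[∑ i ∈ Finset.range t, X i; P] ≤ t * c ^ 2 := by
    rw [IndepFun.variance_sum (fun i _ => hL i)
      (fun i _ j _ hij => (hz.indep.indepFun hij).comp hm hm)]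
    calc _ ≤ ∑ i ∈ Finset.range t, c ^ 2 := by
          refine Finset.sum_le_sum fun i _ => ?_
          refine (variance_le_expectation_sq (hXm i).aestronglyMeasurable).trans ?_
          have : ∫ s, (X i ^ 2) s ∂P ≤ ∫ _, c ^ 2 ∂P := by
            refine integral_mono_ae (hL i).integrable_sq (integrable_const _)
              (hae.mono fun s hs => ?_)
            simp only [Pi.pow_apply]
            rw [← sq_abs]
            exact pow_le_pow_left₀ (abs_nonneg _) (hs i) 2
          simpa using this
      _ = _ := by simp
  have hLs : MemLp (∑ i ∈ Finset.range t, X i) 2 P := memLp_finsetSum' _ fun i _ => hL i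
  have hEs : ∫ s, (∑ i ∈ Finset.range t, X i) s ∂P = t * m := by
    simp only [Finset.sum_apply]
    rw [integral_finsetSum _ fun i _ => (hL i).integrable (by norm_num)]
    simp [hE]
  have hsq : IntegralEq P (fun s => ((∑ i ∈ Finset.range t, X i) s - t * m) ^ 2)
      (Var[∑ i ∈ Finset.range t, X i; P]) := by
    refine ⟨(hLs.sub (memLp_const _)).integrable_sq, ?_⟩
    rw [variance_eq_integral hLs.aemeasurable, hEs]
  have hr : 0 < √(t : ℝ) := Real.sqrt_pos.2 ht0
  have hrr : √(t : ℝ) ^ 2 = t := Real.sq_sqrt ht0.le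
  -- AM-GM majorant of the absolute error, balanced at the expected size c / √t.
  set R : S → ℝ := fun s => √t / (2 * c * t ^ 2) * ((∑ i ∈ Finset.range t, X i) s - t * m) ^ 2
    + c / (2 * √t) with hR
  have hRI := (hsq.const_mul (√t / (2 * c * t ^ 2))).add (IntegralEq.const (c / (2 * √t)))
  have hle : ∀ s, |(∑ i ∈ Finset.range t, h (z i s)) / t - m| ≤ R s := by
    intro s
    have e : (∑ i ∈ Finset.range t, h (z i s)) / t - m =
        ((∑ i ∈ Finset.range t, X i) s - t * m) / t := by
      rw [Finset.sum_apply, hX]; field_simp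
    rw [e]
    set y := (∑ i ∈ Finset.range t, X i) s - t * m with hy
    have : R s - |y / t| = √t / (2 * c) * (|y / t| - c / √t) ^ 2 := by
      simp only [hR, ← hy]
      have : y ^ 2 = |y / t| ^ 2 * t ^ 2 := by rw [sq_abs]; field_simp
      rw [this]
      field_simp
      ring_nf
    have h2 : 0 ≤ √t / (2 * c) * (|y / t| - c / √t) ^ 2 := by positivity
    linarith
  calc _ ≤ ∫⁻ s, ENNReal.ofReal (R s) ∂P :=
        lintegral_mono fun s => ENNReal.ofReal_le_ofReal (hle s)
    _ = ENNReal.ofReal (∫ s, R s ∂P) :=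
        (ofReal_integral_eq_lintegral_ofReal hRI.1
          (Filter.Eventually.of_forall fun s => (abs_nonneg _).trans (hle s))).symm
    _ ≤ _ := by
        refine ENNReal.ofReal_le_ofReal ?_
        rw [hRI.2]
        have : √t / (2 * c * t ^ 2) * Var[∑ i ∈ Finset.range t, X i; P] ≤
            √t / (2 * c * t ^ 2) * (t * c ^ 2) := by gcongr
        refine (add_le_add_left this _).trans_eq ?_
        rw [probReal_univ]
        field_simp
        rw [hrr]
        ring

theorem norm_le_sum_abs (a : E d) : ‖a‖ ≤ ∑ j, |a j| := by
  have h := (EuclideanSpace.basisFun (Fin d) ℝ).sum_repr a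
  calc ‖a‖ = ‖∑ j, a j • EuclideanSpace.basisFun (Fin d) ℝ j‖ := by
        conv_lhs => rw [← h]
        simp
    _ ≤ _ := (norm_sum_le _ _).trans_eq (by simp [norm_smul])

/-- Valid also when the class has not occurred yet: both sides are then 0. -/
theorem empMean_smul_count (y : ℤˣ) (z : ℕ → Example d) (t : ℕ) :
    (∑ i ∈ Finset.range t, if (z i).2 = y then (1 : ℝ) else 0) • empMean y z t =
      ∑ i ∈ Finset.range t, if (z i).2 = y then (z i).1 else 0 := by
  unfold empMean
  by_cases h : (∑ i ∈ Finset.range t, if (z i).2 = y then (1 : ℝ) else 0) = 0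
  · rw [h, zero_smul]
    rw [Finset.sum_eq_zero_iff_of_nonneg (fun i _ => by split_ifs <;> simp)] at h
    refine (Finset.sum_eq_zero fun i hi => ?_).symm
    have := h i hi
    simp only [ite_eq_right_iff, one_ne_zero, imp_false] at this
    rw [if_neg this]
  · rw [smul_inv_smul₀ h]

theorem norm_empMean_le {κ : ℝ} (hκ : 0 ≤ κ) (y : ℤˣ) {z : ℕ → Example d}
    (hz : ∀ i, ‖(z i).1‖ ≤ κ) (t : ℕ) : ‖empMean y z t‖ ≤ κ := by
  set N := ∑ i ∈ Finset.range t, if (z i).2 = y then (1 : ℝ) else 0 with hN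
  have hN0 : 0 ≤ N := Finset.sum_nonneg fun i _ => by split_ifs <;> simp
  have hS : ‖∑ i ∈ Finset.range t, if (z i).2 = y then (z i).1 else 0‖ ≤ N * κ := by
    rw [hN, Finset.sum_mul]
    refine (norm_sum_le _ _).trans (Finset.sum_le_sum fun i _ => ?_)
    split_ifs <;> simp [hz i]
  unfold empMean
  rw [← hN, norm_smul, norm_inv, Real.norm_of_nonneg hN0]
  rcases hN0.eq_or_lt with h | h
  · rw [← h]; simpa using hκ
  · rwa [inv_mul_le_iff₀ h]

theorem empProb_nonneg (z : ℕ → Example d) (t : ℕ) : 0 ≤ empProb z t :=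
  div_nonneg (Finset.sum_nonneg fun i _ => by split_ifs <;> simp) (Nat.cast_nonneg t)

theorem empProb_le_one (z : ℕ → Example d) (t : ℕ) : empProb z t ≤ 1 := by
  refine div_le_one_of_le₀ ?_ (Nat.cast_nonneg t)
  calc _ ≤ ∑ i ∈ Finset.range t, (1 : ℝ) :=
        Finset.sum_le_sum fun i _ => by split_ifs <;> simp
    _ = t := by simp

/-- The error of an empirical class mean in terms of the errors of two empirical averages. -/
theorem norm_empMean_sub_le {ρ : Measure (Example d)} [IsProbabilityMeasure ρ] {κ : ℝ}
    (hκ : 0 ≤ κ) (y : ℤˣ) (hy : 0 < ρ.real {z | z.2 = y}) (hb : ∀ᵐ x ∂ρ, ‖x.1‖ ≤ κ)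
    {z : ℕ → Example d} (hz : ∀ i, ‖(z i).1‖ ≤ κ) {t : ℕ} (ht : 1 ≤ t) :
    ‖empMean y z t - classMean ρ y‖ ≤ (ρ.real {z | z.2 = y})⁻¹ *
      (κ * |(∑ i ∈ Finset.range t, if (z i).2 = y then (1 : ℝ) else 0) / t
          - ∫ x, (if x.2 = y then (1 : ℝ) else 0) ∂ρ|
        + ∑ j, |(∑ i ∈ Finset.range t, if (z i).2 = y then (z i).1 j else 0) / t
          - ∫ x, (if x.2 = y then x.1 j else 0) ∂ρ|) := by
  have ht0 : (t : ℝ) ≠ 0 := by positivity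
  set r := ρ.real {z : Example d | z.2 = y} with hr
  set N := ∑ i ∈ Finset.range t, if (z i).2 = y then (1 : ℝ) else 0 with hN
  set V := ∑ i ∈ Finset.range t, if (z i).2 = y then (z i).1 else 0 with hV
  set m := ∫ x in {x : Example d | x.2 = y}, x.1 ∂ρ with hm
  have ix : Integrable (fun x : Example d => x.1) ρ :=
    Integrable.of_bound measurable_fst.aestronglyMeasurable _ hb
  have e1 : ∫ x : Example d, (if x.2 = y then (1 : ℝ) else 0) ∂ρ = r := by
    have := integral_indicator_one (μ := ρ) (measurableSet_label (d := d) y)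
    rw [hr, ← this]
    congr 1
    ext x
    simp [Set.indicator_apply]
  have e2 : ∀ j, ∫ x : Example d, (if x.2 = y then x.1 j else 0) ∂ρ = m j := by
    intro j
    have h1 := (EuclideanSpace.proj (𝕜 := ℝ) j).integral_comp_comm
      (ix.integrableOn (s := {x : Example d | x.2 = y}))
    have h2 := integral_indicator (μ := ρ) (f := fun x : Example d => x.1 j)
      (measurableSet_label (d := d) y)
    rw [hm]
    refine Eq.trans ?_ (h2.trans h1)
    congr 1
    ext x
    simp [Set.indicator_apply]
  have e3 : N • empMean y z t = V := empMean_smul_count y z t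
  have e4 : r • classMean ρ y = m := by
    rw [classMean, smul_inv_smul₀ hy.ne']
  have e5 : ∀ j, ∑ i ∈ Finset.range t, (if (z i).2 = y then (z i).1 j else 0) = V j := by
    intro j
    rw [hV, WithLp.ofLp_sum, Finset.sum_apply]
    refine Finset.sum_congr rfl fun i _ => ?_
    split_ifs <;> simp
  -- Multiplying by the population mass r avoids dividing by the random count N, which may be small
  -- or zero.
  have key : r • (empMean y z t - classMean ρ y) =
      (r - N / t) • empMean y z t + ((t : ℝ)⁻¹ • V - m) := by
    rw [smul_sub, e4, ← e3, sub_smul, smul_smul, div_eq_inv_mul]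
    abel
  rw [le_inv_mul_iff₀ hy]
  calc r * ‖empMean y z t - classMean ρ y‖ = ‖r • (empMean y z t - classMean ρ y)‖ := by
        rw [norm_smul, Real.norm_of_nonneg hy.le]
    _ ≤ |r - N / t| * κ + ∑ j, |((t : ℝ)⁻¹ • V - m) j| := by
        rw [key]
        refine (norm_add_le _ _).trans (add_le_add ?_ (norm_le_sum_abs _))
        rw [norm_smul, Real.norm_eq_abs]
        gcongr
        exact norm_empMean_le hκ y hz t
    _ = _ := by
        rw [e1, abs_sub_comm, mul_comm]
        congr 1
        refine Finset.sum_congr rfl fun j _ => ?_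
        rw [e2, e5]
        simp [div_eq_inv_mul]

/-! ### Errors of the empirical class statistics -/

theorem lintegral_mul_mul_add_sum_le {S ι : Type*} [Fintype ι] [MeasurableSpace S] {P : Measure S}
    (r k : ENNReal) {f : S → ENNReal} {g : ι → S → ENNReal} (hf : Measurable f)
    (hg : ∀ j, Measurable (g j)) {a : ENNReal} {b : ι → ENNReal} (ha : ∫⁻ s, f s ∂P ≤ a)
    (hb : ∀ j, ∫⁻ s, g j s ∂P ≤ b j) :
    ∫⁻ s, r * (k * f s + ∑ j, g j s) ∂P ≤ r * (k * a + ∑ j, b j) := by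
  rw [lintegral_const_mul r (f := fun s => k * f s + ∑ j, g j s) ((hf.const_mul k).add (Finset.measurable_fun_sum _ fun j _ => hg j)),
    lintegral_add_left (hf.const_mul k), lintegral_const_mul k hf,
    lintegral_finsetSum _ fun j _ => hg j]
  gcongr with j
  exact hb j

theorem lintegral_norm_empMean_sub_le {S : Type*} [MeasurableSpace S] {P : Measure S}
    [IsProbabilityMeasure P] {ρ : Measure (Example d)} [IsProbabilityMeasure ρ]
    {z : ℕ → S → Example d} (hz : IsSample P ρ z) {κ : ℝ} (hκ : 1 ≤ κ)
    (hb : ∀ᵐ x ∂ρ, ‖x.1‖ ≤ κ) (y : ℤˣ) (hy : 0 < ρ.real {z | z.2 = y}) {t : ℕ} (ht : 1 ≤ t) :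
    ∫⁻ s, ENNReal.ofReal ‖empMean y (fun i => z i s) t - classMean ρ y‖ ∂P ≤
      ENNReal.ofReal ((ρ.real {z | z.2 = y})⁻¹ * (κ * (1 + d)) / √t) := by
  have hκ0 : 0 < κ := by linarith
  set r := (ρ.real {z : Example d | z.2 = y})⁻¹ with hr
  have hr0 : 0 < r := inv_pos.2 hy
  have m1 := measurable_label_ite (d := d) y
  have m2 : ∀ j, Measurable fun x : Example d => if x.2 = y then x.1 j else 0 := fun j =>
    Measurable.ite (measurableSet_label y) (by fun_prop) measurable_const
  have mm : ∀ {h : Example d → ℝ}, Measurable h → Measurable fun s =>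
      ENNReal.ofReal |(∑ i ∈ Finset.range t, h (z i s)) / t - ∫ x, h x ∂ρ| := by
    intro h hh
    have : Measurable fun s => ∑ i ∈ Finset.range t, h (z i s) :=
      Finset.measurable_fun_sum _ fun i _ => hh.comp (hz.measurable i)
    exact (continuous_abs.measurable.comp ((this.div_const _).sub_const _)).ennreal_ofReal
  have l1 := hz.lintegral_abs_mean_sub_le m1 (c := 1) one_pos
    (Filter.Eventually.of_forall fun x => by split_ifs <;> simp) ht
  have l2 := fun j => hz.lintegral_abs_mean_sub_le (m2 j) (c := κ) hκ0
    (hb.mono fun x hx => by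
      split_ifs
      · exact (PiLp.norm_apply_le x.1 j).trans hx
      · simpa using hκ0.le) ht
  calc _ ≤ ∫⁻ s, ENNReal.ofReal r * (ENNReal.ofReal κ * ENNReal.ofReal
        |(∑ i ∈ Finset.range t, if (z i s).2 = y then (1 : ℝ) else 0) / t
          - ∫ x, (if x.2 = y then (1 : ℝ) else 0) ∂ρ|
        + ∑ j, ENNReal.ofReal |(∑ i ∈ Finset.range t, if (z i s).2 = y then (z i s).1 j else 0) / t
          - ∫ x, (if x.2 = y then x.1 j else 0) ∂ρ|) ∂P := by
        refine lintegral_mono_ae ((hz.ae_bound hb).mono fun s hs => ?_)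
        refine (ENNReal.ofReal_le_ofReal
          (norm_empMean_sub_le hκ0.le y hy hb (z := fun i => z i s) hs ht)).trans_eq ?_
        rw [ENNReal.ofReal_mul hr0.le, ENNReal.ofReal_add (by positivity)
          (Finset.sum_nonneg fun j _ => abs_nonneg _), ENNReal.ofReal_mul hκ0.le,
          ENNReal.ofReal_sum_of_nonneg fun j _ => abs_nonneg _]
    _ ≤ ENNReal.ofReal r * (ENNReal.ofReal κ * ENNReal.ofReal (1 / √t)
        + ∑ j : Fin d, ENNReal.ofReal (κ / √t)) := by
        exact lintegral_mul_mul_add_sum_le _ _ (mm m1) (fun j => mm (m2 j)) l1 l2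
    _ = _ := by
        rw [← ENNReal.ofReal_sum_of_nonneg fun j _ => by positivity, ← ENNReal.ofReal_mul hκ0.le,
          ← ENNReal.ofReal_add (by positivity) (by positivity), ← ENNReal.ofReal_mul hr0.le]
        congr 1
        simp
        ring

/-- The total error of the empirical class probability and the empirical class means. -/
def classError (ρ : Measure (Example d)) (z : ℕ → Example d) (t : ℕ) : ℝ :=
  |empProb z t - posProb ρ| + ‖empMean 1 z t - classMean ρ 1‖
    + ‖empMean (-1) z t - classMean ρ (-1)‖

theorem classError_nonneg (ρ : Measure (Example d)) (z : ℕ → Example d) (t : ℕ) :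
    0 ≤ classError ρ z t := by
  unfold classError
  positivity

/-! ### The past of the sample -/

section Past

variable {S : Type*} {z : ℕ → S → Example d}

/-- The σ-algebra generated by `z_0, …, z_{t-1}`. -/
abbrev past (z : ℕ → S → Example d) (t : ℕ) : MeasurableSpace S :=
  ⨆ i ∈ Set.Iio t, MeasurableSpace.comap (z i) inferInstance

theorem measurable_past {i t : ℕ} (h : i < t) : Measurable[past z t] (z i) :=
  (comap_measurable (z i)).mono
    (le_iSup₂_of_le (f := fun i (_ : i ∈ Set.Iio t) => MeasurableSpace.comap (z i) inferInstance)
      i h le_rfl) le_rfl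

theorem past_mono {t t' : ℕ} (h : t ≤ t') : past z t ≤ past z t' :=
  biSup_mono fun _ hi => lt_of_lt_of_le hi h

theorem past_le [m : MeasurableSpace S] (hz : ∀ t, Measurable (z t)) (t : ℕ) : past z t ≤ m :=
  iSup₂_le fun i _ => (hz i).comap_le

theorem IsSample.indepFun_past [MeasurableSpace S] {P : Measure S} {ρ : Measure (Example d)}
    (hz : IsSample P ρ z) {β : Type*} [MeasurableSpace β] {t : ℕ} {Y : S → β}
    (hY : Measurable[past z t] Y) : IndepFun Y (z t) P := by
  have h := indep_iSup_of_disjoint (fun i => (hz.measurable i).comap_le) hz.indep.iIndep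
    (S := Set.Iio t) (T := {t}) (by simp)
  rw [IndepFun_iff_Indep]
  refine indep_of_indep_of_le_left (indep_of_indep_of_le_right h ?_) hY.comap_le
  exact le_iSup₂_of_le (f := fun i (_ : i ∈ ({t} : Set ℕ)) =>
    MeasurableSpace.comap (z i) inferInstance) t rfl le_rfl

/-- The law of (Y, z_t) is a product, so Tonelli integrates out the fresh example with the past
frozen. This plays the role of conditional expectation. -/
theorem IsSample.lintegral_past [MeasurableSpace S] {P : Measure S} [IsProbabilityMeasure P]
    {ρ : Measure (Example d)} (hz : IsSample P ρ z) {β : Type*} [MeasurableSpace β] {t : ℕ}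
    {Y : S → β} (hY : Measurable[past z t] Y) {F : β × Example d → ENNReal} (hF : Measurable F) :
    ∫⁻ s, F (Y s, z t s) ∂P = ∫⁻ s, ∫⁻ x, F (Y s, x) ∂ρ ∂P := by
  have hYm : Measurable Y := hY.mono (past_le hz.measurable t) le_rfl
  have hzm := hz.measurable t
  have : IsProbabilityMeasure ρ := hz.law t ▸ Measure.isProbabilityMeasure_map hzm.aemeasurable
  have h := (indepFun_iff_map_prod_eq_prod_map_map hYm.aemeasurable hzm.aemeasurable).1
    (hz.indepFun_past hY)
  rw [hz.law t] at h
  rw [← lintegral_map (f := F) (g := fun s => (Y s, z t s)) hF (hYm.prodMk hzm), h,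
    lintegral_prod _ hF.aemeasurable, lintegral_map hF.lintegral_prod_right' hYm]

theorem measurable_empProb (t : ℕ) : Measurable[past z t] fun s => empProb (fun i => z i s) t := by
  have : Measurable[past z t] fun s => ∑ i ∈ Finset.range t, if (z i s).2 = 1 then (1 : ℝ) else 0 :=
    Finset.measurable_fun_sum _ fun i hi =>
      (measurable_label_ite 1).comp (measurable_past (Finset.mem_range.1 hi))
  exact this.div_const _

theorem measurable_empMean (y : ℤˣ) (t : ℕ) :
    Measurable[past z t] fun s => empMean y (fun i => z i s) t := by
  have h1 : Measurable[past z t]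
      fun s => ∑ i ∈ Finset.range t, if (z i s).2 = y then (1 : ℝ) else 0 :=
    Finset.measurable_fun_sum _ fun i hi =>
      (measurable_label_ite y).comp (measurable_past (Finset.mem_range.1 hi))
  have m2 : Measurable fun x : Example d => if x.2 = y then x.1 else 0 :=
    Measurable.ite (measurableSet_label y) measurable_fst measurable_const
  have h2 : Measurable[past z t]
      fun s => ∑ i ∈ Finset.range t, if (z i s).2 = y then (z i s).1 else 0 :=
    Finset.measurable_fun_sum _ fun i hi => m2.comp (measurable_past (Finset.mem_range.1 hi))
  exact h1.inv.smul h2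

theorem measurable_classError (ρ : Measure (Example d)) (t : ℕ) :
    Measurable[past z t] fun s => classError ρ (fun i => z i s) t := by
  have h1 := measurable_empProb (z := z) t
  have h2 := measurable_empMean (z := z) 1 t
  have h3 := measurable_empMean (z := z) (-1) t
  have h : Measurable fun q : ℝ × E d × E d => |q.1 - posProb ρ| + ‖q.2.1 - classMean ρ 1‖
      + ‖q.2.2 - classMean ρ (-1)‖ := by fun_prop
  exact h.comp (h1.prodMk (h2.prodMk h3))

theorem measurable_lossGrad : Measurable fun q : (ℝ × E d × E d × E d) × Example d =>
    lossGrad q.1.1 q.1.2.1 q.1.2.2.1 q.2 q.1.2.2.2 := by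
  have h1 : Measurable fun q : (ℝ × E d × E d × E d) × Example d =>
      if q.2.2 = 1 then (1 : ℝ) else 0 := (measurable_label_ite 1).comp measurable_snd
  have h2 : Measurable fun q : (ℝ × E d × E d × E d) × Example d =>
      if q.2.2 = -1 then (1 : ℝ) else 0 := (measurable_label_ite (-1)).comp measurable_snd
  unfold lossGrad
  fun_prop

theorem measurable_step {Ω : E d → ℝ} (hconv : ConvexOn ℝ Set.univ Ω)
    (hnonneg : ∀ w, 0 ≤ Ω w) {η : ℝ} (hη : 0 ≤ η) :
    Measurable fun q : (ℝ × E d × E d × E d) × Example d =>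
      prox Ω η (q.1.2.2.2 - η • lossGrad q.1.1 q.1.2.1 q.1.2.2.1 q.2 q.1.2.2.2) := by
  have h : Measurable (prox Ω η) := (continuous_prox hconv hnonneg hη).measurable
  have h1 : Measurable fun q : (ℝ × E d × E d × E d) × Example d => q.1.2.2.2 := by fun_prop
  have h2 := measurable_lossGrad (d := d)
  exact h.comp (h1.sub (h2.const_smul η))

/-- The step from w_t to w_{t+1} uses z_0, …, z_t and nothing later, so w_t is determined before z_t
is drawn. -/
theorem measurable_iterates {Ω : E d → ℝ} (hconv : ConvexOn ℝ Set.univ Ω)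
    (hnonneg : ∀ w, 0 ≤ Ω w) {η : ℕ → ℝ} (hη : ∀ t, 1 ≤ t → 0 ≤ η t) {w : ℕ → S → E d}
    (hw : ∀ s, IsIterates Ω η (fun t => z t s) (fun t => w t s)) {t : ℕ} (ht : 1 ≤ t) :
    Measurable[past z t] (w t) := by
  induction t, ht using Nat.le_induction with
  | base =>
    have : w 1 = fun _ => 0 := funext fun s => (hw s).1
    rw [this]
    exact measurable_const
  | succ t ht ih =>
    have e : w (t + 1) = fun s => prox Ω (η t) (w t s - η t • stochGrad (fun i => z i s) t (w t s)) :=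
      funext fun s => eq_prox_of_step hconv hnonneg (hη t ht) ((hw s).2 t ht)
    have le := past_mono (z := z) t.le_succ
    have h : Measurable[past z (t + 1)] fun s => ((empProb (fun i => z i s) t,
        empMean 1 (fun i => z i s) t, empMean (-1) (fun i => z i s) t, w t s), z t s) :=
      (((measurable_empProb t).mono le le_rfl).prodMk (((measurable_empMean 1 t).mono le le_rfl).prodMk
        (((measurable_empMean (-1) t).mono le le_rfl).prodMk (ih.mono le le_rfl)))).prodMk
        (measurable_past t.lt_succ_self)
    have h' := (measurable_step hconv hnonneg (hη t ht)).comp h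
    rw [e]
    exact h'

end Past

/-- The constant is fixed before the probability space and the sample, so it depends only on the
distribution, the bound κ and the dimension. -/
theorem exists_lintegral_classError_le {ρ : Measure (Example d)} [IsProbabilityMeasure ρ]
    {κ : ℝ} (hκ : 1 ≤ κ) (hb : ∀ᵐ x ∂ρ, ‖x.1‖ ≤ κ) (hp : 0 < posProb ρ) (hp' : posProb ρ < 1) :
    ∃ C : ℝ, 0 ≤ C ∧ ∀ (S : Type u) [MeasurableSpace S] (P : Measure S) [IsProbabilityMeasure P]
      (z : ℕ → S → Example d), IsSample P ρ z → ∀ t : ℕ, 1 ≤ t →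
      ∫⁻ s, ENNReal.ofReal (classError ρ (fun i => z i s) t) ∂P ≤ ENNReal.ofReal (C / √t) := by
  have hn : 0 < ρ.real {z : Example d | z.2 = -1} := by
    rw [real_neg_label]; linarith
  refine ⟨1 + (posProb ρ)⁻¹ * (κ * (1 + d)) + (ρ.real {z : Example d | z.2 = -1})⁻¹ * (κ * (1 + d)),
    by positivity, fun S _ P _ z hz t ht => ?_⟩
  have m1 := (measurable_empProb (z := z) t).mono (past_le hz.measurable t) le_rfl
  have m2 := (measurable_empMean (z := z) 1 t).mono (past_le hz.measurable t) le_rfl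
  have l1 := hz.lintegral_abs_mean_sub_le (measurable_label_ite (d := d) 1) (c := 1) one_pos
    (Filter.Eventually.of_forall fun x => by split_ifs <;> simp) ht
  have e1 : ∫ x : Example d, (if x.2 = 1 then (1 : ℝ) else 0) ∂ρ = posProb ρ := by
    rw [posProb, ← integral_indicator_one (measurableSet_label 1)]
    congr 1
    ext x
    simp [Set.indicator_apply]
  rw [e1] at l1
  have l2 := lintegral_norm_empMean_sub_le hz hκ hb 1 hp ht
  have l3 := lintegral_norm_empMean_sub_le hz hκ hb (-1) hn ht
  calc _ = ∫⁻ s, (ENNReal.ofReal |empProb (fun i => z i s) t - posProb ρ|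
        + ENNReal.ofReal ‖empMean 1 (fun i => z i s) t - classMean ρ 1‖)
        + ENNReal.ofReal ‖empMean (-1) (fun i => z i s) t - classMean ρ (-1)‖ ∂P := by
        refine lintegral_congr fun s => ?_
        rw [classError, ENNReal.ofReal_add (by positivity) (by positivity),
          ENNReal.ofReal_add (by positivity) (by positivity)]
    _ ≤ _ := by
        rw [lintegral_add_left (by fun_prop), lintegral_add_left (by fun_prop), add_div, add_div,
          ENNReal.ofReal_add (by positivity) (by positivity),
          ENNReal.ofReal_add (by positivity) (by positivity)]
        exact add_le_add (add_le_add l1 l2) l3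

/-! ### The weighted recursion -/

/-- The relative growth of the expected squared distance to the minimizer at step `t`. -/
def growth (ρ : Measure (Example d)) (K : ℝ) (η : ℕ → ℝ) (z : ℕ → Example d) (t : ℕ) : ℝ :=
  K * (η t * classError ρ z t + η t ^ 2)

/-- The accumulated growth over the steps `1, …, t - 1`. -/
def accGrowth (ρ : Measure (Example d)) (K : ℝ) (η : ℕ → ℝ) (z : ℕ → Example d) (t : ℕ) : ℝ :=
  ∏ i ∈ Finset.Ico 1 t, (1 + growth ρ K η z i)

section Growth

variable {ρ : Measure (Example d)} {K : ℝ} {η : ℕ → ℝ}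

theorem growth_nonneg (hK : 0 ≤ K) (hη : ∀ t, 1 ≤ t → 0 ≤ η t) (z : ℕ → Example d) {t : ℕ}
    (ht : 1 ≤ t) : 0 ≤ growth ρ K η z t :=
  mul_nonneg hK (add_nonneg (mul_nonneg (hη t ht) (classError_nonneg ρ z t)) (sq_nonneg _))

theorem accGrowth_pos (hK : 0 ≤ K) (hη : ∀ t, 1 ≤ t → 0 ≤ η t) (z : ℕ → Example d) (t : ℕ) :
    0 < accGrowth ρ K η z t :=
  Finset.prod_pos fun i hi => by
    linarith [growth_nonneg (ρ := ρ) hK hη z (Finset.mem_Ico.1 hi).1]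

theorem accGrowth_succ (z : ℕ → Example d) {t : ℕ} (ht : 1 ≤ t) :
    accGrowth ρ K η z (t + 1) = accGrowth ρ K η z t * (1 + growth ρ K η z t) :=
  Finset.prod_Ico_succ_top ht _

theorem accGrowth_le_exp (hK : 0 ≤ K) (hη : ∀ t, 1 ≤ t → 0 ≤ η t) (z : ℕ → Example d) {t T : ℕ}
    (ht : t ≤ T) :
    accGrowth ρ K η z (t + 1) ≤ Real.exp (∑ i ∈ Finset.Icc 1 T, growth ρ K η z i) := by
  rw [Real.exp_sum]
  calc accGrowth ρ K η z (t + 1) ≤ ∏ i ∈ Finset.Ico 1 (t + 1), Real.exp (growth ρ K η z i) := by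
        refine Finset.prod_le_prod (fun i hi => ?_) fun i hi => ?_
        · linarith [growth_nonneg (ρ := ρ) hK hη z (Finset.mem_Ico.1 hi).1]
        · rw [add_comm]; exact Real.add_one_le_exp _
    _ ≤ _ := by
        refine Finset.prod_le_prod_of_subset_of_one_le (fun i hi => ?_) (fun i _ => by positivity)
          fun i hi _ => Real.one_le_exp (growth_nonneg hK hη z (Finset.mem_Icc.1 hi).1)
        rw [Finset.mem_Ico] at hi
        rw [Finset.mem_Icc]
        omega

theorem measurable_growth {S : Type*} {z : ℕ → S → Example d} {i t : ℕ} (h : i ≤ t) :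
    Measurable[past z t] fun s => growth ρ K η (fun j => z j s) i :=
  (((((measurable_classError ρ i).mono (past_mono h) le_rfl).const_mul (η i)).add_const
    (η i ^ 2)).const_mul K)

/-- The growth at step t involves only the statistics of z_0, …, z_{t-1}. The product through step t
is thus known before z_t and can be used as a weight for that step. -/
theorem measurable_accGrowth {S : Type*} {z : ℕ → S → Example d} (t : ℕ) :
    Measurable[past z t] fun s => accGrowth ρ K η (fun j => z j s) (t + 1) :=
  Finset.measurable_fun_prod _ fun _ hi =>
    (measurable_growth (Nat.lt_succ_iff.1 (Finset.mem_Ico.1 hi).2)).const_add 1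

end Growth

/-- With the past frozen, the one-step bound applies with weight 1 / Q_{t+1}, and its factor 1 + g_t
cancels the last factor of Q_{t+1}. -/
theorem lintegral_weighted_step_le {ρ : Measure (Example d)} [IsProbabilityMeasure ρ] {κ : ℝ}
    (hκ : 0 ≤ κ) (hb : ∀ᵐ z ∂ρ, ‖z.1‖ ≤ κ) {Ω : E d → ℝ} (hconv : ConvexOn ℝ Set.univ Ω)
    (hnonneg : ∀ w, 0 ≤ Ω w) {A₁ : ℝ} {v₀ : E d} {K : ℝ} (hK : 0 ≤ K)
    (hstep : IsStepConstant ρ Ω κ A₁ v₀ K) {η : ℕ → ℝ} (hη : ∀ t, 1 ≤ t → 0 ≤ η t)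
    (hη' : ∀ t, 1 ≤ t → 2 * A₁ * η t ≤ 1) {S : Type*} [MeasurableSpace S] {P : Measure S}
    [IsProbabilityMeasure P] {z : ℕ → S → Example d} (hz : IsSample P ρ z) {w : ℕ → S → E d}
    (hw : ∀ s, IsIterates Ω η (fun t => z t s) (fun t => w t s)) {t : ℕ} (ht : 1 ≤ t) :
    ∫⁻ s, ENNReal.ofReal (accGrowth ρ K η (fun j => z j s) (t + 1))⁻¹
        * ENNReal.ofReal (1 + ‖w (t + 1) s - v₀‖ ^ 2) ∂P
      + ∫⁻ s, ENNReal.ofReal (accGrowth ρ K η (fun j => z j s) (t + 1))⁻¹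
        * ENNReal.ofReal (η t * (objective ρ Ω (w t s) - objective ρ Ω v₀)) ∂P
    ≤ ∫⁻ s, ENNReal.ofReal (accGrowth ρ K η (fun j => z j s) t)⁻¹
        * ENNReal.ofReal (1 + ‖w t s - v₀‖ ^ 2) ∂P := by
  have e : ∀ s, w (t + 1) s =
      prox Ω (η t) (w t s - η t • stochGrad (fun i => z i s) t (w t s)) :=
    fun s => eq_prox_of_step hconv hnonneg (hη t ht) ((hw s).2 t ht)
  have hY : Measurable[past z t] fun s => (accGrowth ρ K η (fun j => z j s) (t + 1),
      (empProb (fun i => z i s) t, empMean 1 (fun i => z i s) t, empMean (-1) (fun i => z i s) t,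
        w t s)) :=
    (measurable_accGrowth t).prodMk ((measurable_empProb t).prodMk ((measurable_empMean 1 t).prodMk
      ((measurable_empMean (-1) t).prodMk (measurable_iterates hconv hnonneg hη hw ht))))
  have hG : Measurable fun q : (ℝ × ℝ × E d × E d × E d) × Example d =>
      prox Ω (η t) (q.1.2.2.2.2 - η t • lossGrad q.1.2.1 q.1.2.2.1 q.1.2.2.2.1 q.2 q.1.2.2.2.2) := by
    have h : Measurable fun q : (ℝ × ℝ × E d × E d × E d) × Example d => (q.1.2, q.2) := by
      fun_prop
    have h' := (measurable_step hconv hnonneg (hη t ht)).comp h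
    exact h'
  have hF : Measurable fun q : (ℝ × ℝ × E d × E d × E d) × Example d =>
      ENNReal.ofReal q.1.1⁻¹ * ENNReal.ofReal (1 + ‖prox Ω (η t) (q.1.2.2.2.2
        - η t • lossGrad q.1.2.1 q.1.2.2.1 q.1.2.2.2.1 q.2 q.1.2.2.2.2) - v₀‖ ^ 2) := by
    fun_prop
  have h1 := hz.lintegral_past hY hF
  simp only [lintegral_const_mul' _ _ ENNReal.ofReal_ne_top] at h1
  simp only [e, stochGrad]
  rw [h1]
  -- Superadditivity of the lower integral, which asks for no measurability of the summands.
  refine (le_lintegral_add _ _).trans (lintegral_mono_ae ((hz.ae_bound hb).mono fun s hs => ?_))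
  rw [← mul_add]
  refine (mul_le_mul_right (hstep (η t) (hη t ht) (hη' t ht) _ _ _
    (empProb_nonneg (fun i => z i s) t) (empProb_le_one _ t)
    (norm_empMean_le hκ 1 (z := fun i => z i s) hs t)
    (norm_empMean_le hκ (-1) (z := fun i => z i s) hs t) (w t s)) _).trans_eq ?_
  have g0 := growth_nonneg (ρ := ρ) hK hη (fun i => z i s) ht
  have a0 := accGrowth_pos (ρ := ρ) hK hη (fun i => z i s) t
  change _ * ENNReal.ofReal ((1 + growth ρ K η (fun i => z i s) t) * _) = _
  rw [← ENNReal.ofReal_mul (inv_nonneg.2 (accGrowth_pos hK hη _ _).le),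
    ← ENNReal.ofReal_mul (inv_nonneg.2 a0.le), accGrowth_succ _ ht]
  congr 1
  have : 1 + growth ρ K η (fun i => z i s) t ≠ 0 := by linarith
  field_simp

/-- Telescoping from w_1 = 0 and an empty product, whose contribution is 1 + ‖v₀‖²; the final
distance term is dropped. -/
theorem sum_lintegral_weighted_le {ρ : Measure (Example d)} [IsProbabilityMeasure ρ] {κ : ℝ}
    (hκ : 0 ≤ κ) (hb : ∀ᵐ z ∂ρ, ‖z.1‖ ≤ κ) {Ω : E d → ℝ} (hconv : ConvexOn ℝ Set.univ Ω)
    (hnonneg : ∀ w, 0 ≤ Ω w) {A₁ : ℝ} {v₀ : E d} {K : ℝ} (hK : 0 ≤ K)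
    (hstep : IsStepConstant ρ Ω κ A₁ v₀ K) {η : ℕ → ℝ} (hη : ∀ t, 1 ≤ t → 0 ≤ η t)
    (hη' : ∀ t, 1 ≤ t → 2 * A₁ * η t ≤ 1) {S : Type*} [MeasurableSpace S] {P : Measure S}
    [IsProbabilityMeasure P] {z : ℕ → S → Example d} (hz : IsSample P ρ z) {w : ℕ → S → E d}
    (hw : ∀ s, IsIterates Ω η (fun t => z t s) (fun t => w t s)) (T : ℕ) :
    ∑ t ∈ Finset.Icc 1 T, ∫⁻ s, ENNReal.ofReal (accGrowth ρ K η (fun j => z j s) (t + 1))⁻¹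
        * ENNReal.ofReal (η t * (objective ρ Ω (w t s) - objective ρ Ω v₀)) ∂P
    ≤ ENNReal.ofReal (1 + ‖v₀‖ ^ 2) := by
  have key : ∀ T : ℕ, ∫⁻ s, ENNReal.ofReal (accGrowth ρ K η (fun j => z j s) (T + 1))⁻¹
        * ENNReal.ofReal (1 + ‖w (T + 1) s - v₀‖ ^ 2) ∂P
      + ∑ t ∈ Finset.Icc 1 T, ∫⁻ s, ENNReal.ofReal (accGrowth ρ K η (fun j => z j s) (t + 1))⁻¹
        * ENNReal.ofReal (η t * (objective ρ Ω (w t s) - objective ρ Ω v₀)) ∂P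
      ≤ ENNReal.ofReal (1 + ‖v₀‖ ^ 2) := by
    intro T
    induction T with
    | zero =>
      have : ∀ s, w 1 s = 0 := fun s => (hw s).1
      simp [this, accGrowth]
    | succ T ih =>
      rw [Finset.sum_Icc_succ_top (by omega), add_comm (∑ t ∈ Finset.Icc 1 T, _), ← add_assoc]
      refine le_trans (add_le_add_left ?_ _) ih
      exact lintegral_weighted_step_le hκ hb hconv hnonneg hK hstep hη hη' hz hw (by omega)
  exact le_add_self.trans (key T)

/-! ### High-probability bounds -/

theorem measure_ge_le_of_lintegral_le {S : Type*} [MeasurableSpace S] {P : Measure S} {f : S → ℝ}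
    (hf : Measurable f) {a M ε : ℝ} (h : ∫⁻ s, ENNReal.ofReal (f s) ∂P ≤ ENNReal.ofReal a)
    (hM : 0 < M) (hε : a / M ≤ ε) : P {s | M ≤ f s} ≤ ENNReal.ofReal ε := by
  calc P {s | M ≤ f s} ≤ P {s | ENNReal.ofReal M ≤ ENNReal.ofReal (f s)} :=
        measure_mono fun s hs => ENNReal.ofReal_le_ofReal hs
    _ ≤ (∫⁻ s, ENNReal.ofReal (f s) ∂P) / ENNReal.ofReal M :=
        meas_ge_le_lintegral_div hf.ennreal_ofReal.aemeasurable (by simpa using hM)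
          ENNReal.ofReal_ne_top
    _ ≤ ENNReal.ofReal a / ENNReal.ofReal M := ENNReal.div_le_div_right h _
    _ = ENNReal.ofReal (a / M) := (ENNReal.ofReal_div_of_pos hM).symm
    _ ≤ _ := ENNReal.ofReal_le_ofReal hε

theorem lintegral_ofReal_sum_le {S ι : Type*} [MeasurableSpace S] {P : Measure S} {A : Finset ι}
    {f : ι → S → ℝ} (hf : ∀ i ∈ A, Measurable (f i)) :
    ∫⁻ s, ENNReal.ofReal (∑ i ∈ A, f i s) ∂P ≤ ∑ i ∈ A, ∫⁻ s, ENNReal.ofReal (f i s) ∂P := by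
  rw [← lintegral_finsetSum' _ fun i hi => (hf i hi).ennreal_ofReal.aemeasurable]
  refine lintegral_mono fun s => ?_
  exact Finset.le_sum_of_subadditive _ (by simp) (fun _ _ => ENNReal.ofReal_add_le) _ _

/-- Two Markov bounds at level δ/2: one for the weighted gaps, one for the total growth. Off both
exceptional events the weights are at least exp (-MA), so they can be removed. -/
theorem exists_prob_weighted_sum_le {ρ : Measure (Example d)} [IsProbabilityMeasure ρ] {κ : ℝ}
    (hκ : 1 ≤ κ) (hb : ∀ᵐ z ∂ρ, ‖z.1‖ ≤ κ) (hp : 0 < posProb ρ) (hp' : posProb ρ < 1)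
    {Ω : E d → ℝ} (hconv : ConvexOn ℝ Set.univ Ω) (hnonneg : ∀ w, 0 ≤ Ω w)
    {A₁ A₂ : ℝ} (hA₁ : 0 ≤ A₁) (hA₂ : 0 ≤ A₂) (hself : SelfBounding Ω A₁ A₂)
    {v₀ : E d} (hv₀ : v₀ ∈ minimizers (objective ρ Ω)) {δ : ℝ} (hδ : 0 < δ)
    {η : ℕ → ℝ} (hη : ∀ t, 1 ≤ t → 0 ≤ η t) (hη' : ∀ t, 1 ≤ t → 2 * A₁ * η t ≤ 1)
    {B₀ : ℝ} (hB₀ : ∀ T, ∑ t ∈ Finset.Icc 1 T, (η t / √t + η t ^ 2) ≤ B₀) :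
    ∃ B : ℝ, 0 ≤ B ∧ ∀ (S : Type u) [MeasurableSpace S] (P : Measure S) [IsProbabilityMeasure P]
      (z : ℕ → S → Example d) (w : ℕ → S → E d), IsSample P ρ z →
      (∀ s, IsIterates Ω η (fun t => z t s) (fun t => w t s)) → ∀ T : ℕ,
      ENNReal.ofReal (1 - δ) ≤ P {s | ∑ t ∈ Finset.Icc 1 T,
        η t * (objective ρ Ω (w t s) - objective ρ Ω v₀) ≤ B} := by
  obtain ⟨K, hK, hstep⟩ := exists_isStepConstant hκ hb hp hp' hconv hnonneg hA₁ hA₂ hself hv₀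
  obtain ⟨C, hC, herr⟩ := exists_lintegral_classError_le.{u} hκ hb hp hp'
  have hB₀0 : 0 ≤ B₀ := by simpa using hB₀ 0
  -- Bound on the expected total growth; C + 1 dominates both the coefficient C of η_t / √t and the
  -- coefficient 1 of η_t².
  set A := K * ((C + 1) * B₀) with hA
  have hA0 : 0 ≤ A := by positivity
  -- A + 1 keeps this threshold positive even if A = 0.
  set MA := 2 * (A + 1) / δ with hMA
  set MD := 2 * (1 + ‖v₀‖ ^ 2) / δ with hMD
  have hMA0 : 0 < MA := by positivity
  have hMD0 : 0 < MD := by positivity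
  refine ⟨Real.exp MA * MD, by positivity, fun S _ P _ z w hz hw T => ?_⟩
  have hφ : Continuous (objective ρ Ω) :=
    ((convexOn_aucRisk hb hp hp').add hconv).locallyLipschitz.continuous
  have mQ : ∀ t, Measurable fun s => accGrowth ρ K η (fun j => z j s) (t + 1) := fun t =>
    (measurable_accGrowth t).mono (past_le hz.measurable t) le_rfl
  have mG : ∀ t, Measurable fun s => growth ρ K η (fun j => z j s) t := fun t =>
    (measurable_growth le_rfl).mono (past_le hz.measurable t) le_rfl
  have mw : ∀ t, 1 ≤ t → Measurable (w t) := fun t ht =>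
    (measurable_iterates hconv hnonneg hη hw ht).mono (past_le hz.measurable t) le_rfl
  set f : ℕ → S → ℝ := fun t s => (accGrowth ρ K η (fun j => z j s) (t + 1))⁻¹
    * (η t * (objective ρ Ω (w t s) - objective ρ Ω v₀)) with hf
  have mf : ∀ t ∈ Finset.Icc 1 T, Measurable (f t) := fun t ht =>
    (mQ t).inv.mul (((hφ.measurable.comp (mw t (Finset.mem_Icc.1 ht).1)).sub_const _).const_mul _)
  have hU₁ : P {s | MD ≤ ∑ t ∈ Finset.Icc 1 T, f t s} ≤ ENNReal.ofReal (δ / 2) := by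
    refine measure_ge_le_of_lintegral_le (Finset.measurable_fun_sum _ mf)
      (a := 1 + ‖v₀‖ ^ 2) ?_ hMD0 (le_of_eq (by rw [hMD]; field_simp))
    refine (lintegral_ofReal_sum_le mf).trans (le_trans (le_of_eq ?_)
      (sum_lintegral_weighted_le (by linarith) hb hconv hnonneg hK hstep hη hη' hz hw T))
    refine Finset.sum_congr rfl fun t _ => lintegral_congr fun s => ?_
    rw [← ENNReal.ofReal_mul (inv_nonneg.2 (accGrowth_pos hK hη _ _).le)]
  have hU₂ : P {s | MA ≤ ∑ t ∈ Finset.Icc 1 T, growth ρ K η (fun j => z j s) t} ≤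
      ENNReal.ofReal (δ / 2) := by
    refine measure_ge_le_of_lintegral_le (Finset.measurable_fun_sum _ fun t _ => mG t)
      (a := A) ?_ hMA0 ?_
    · refine (lintegral_ofReal_sum_le fun t _ => mG t).trans ?_
      have hterm : ∀ t ∈ Finset.Icc 1 T,
          ∫⁻ s, ENNReal.ofReal (growth ρ K η (fun j => z j s) t) ∂P ≤
            ENNReal.ofReal (K * ((C + 1) * (η t / √t + η t ^ 2))) := by
        intro t ht
        have ht1 := (Finset.mem_Icc.1 ht).1
        have hηt := hη t ht1
        calc _ = ∫⁻ s, ENNReal.ofReal (K * η t) *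
              ENNReal.ofReal (classError ρ (fun j => z j s) t)
              + ENNReal.ofReal (K * η t ^ 2) ∂P := by
              refine lintegral_congr fun s => ?_
              have := classError_nonneg ρ (fun j => z j s) t
              rw [← ENNReal.ofReal_mul (by positivity),
                ← ENNReal.ofReal_add (by positivity) (by positivity), growth]
              congr 1
              ring
          _ ≤ ENNReal.ofReal (K * η t) * ENNReal.ofReal (C / √t) + ENNReal.ofReal (K * η t ^ 2) := by
              rw [lintegral_add_right _ measurable_const,
                lintegral_const_mul' _ _ ENNReal.ofReal_ne_top]
              simp only [lintegral_const, measure_univ, mul_one]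
              gcongr
              exact herr S P z hz t ht1
          _ ≤ _ := by
              rw [← ENNReal.ofReal_mul (by positivity),
                ← ENNReal.ofReal_add (by positivity) (by positivity)]
              refine ENNReal.ofReal_le_ofReal ?_
              have h1 : 0 ≤ η t / √t := by positivity
              have h2 : 0 ≤ C * η t ^ 2 := by positivity
              have e1 : K * η t * (C / √t) + K * η t ^ 2 = K * (C * (η t / √t) + η t ^ 2) := by ring
              rw [e1]
              gcongr
              linarith
      refine (Finset.sum_le_sum hterm).trans ?_
      rw [← ENNReal.ofReal_sum_of_nonneg fun t ht => by
        have := hη t (Finset.mem_Icc.1 ht).1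
        positivity]
      refine ENNReal.ofReal_le_ofReal ?_
      rw [← Finset.mul_sum, ← Finset.mul_sum, hA]
      gcongr
      exact hB₀ T
    · rw [hMA, div_div_eq_mul_div, div_le_iff₀ (by positivity)]
      nlinarith
  -- Covering the whole space bounds the good event from below by subadditivity alone, without
  -- measurability of its complement.
  have hcover : (Set.univ : Set S) ⊆ {s | ∑ t ∈ Finset.Icc 1 T,
        η t * (objective ρ Ω (w t s) - objective ρ Ω v₀) ≤ Real.exp MA * MD} ∪
      ({s | MD ≤ ∑ t ∈ Finset.Icc 1 T, f t s} ∪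
        {s | MA ≤ ∑ t ∈ Finset.Icc 1 T, growth ρ K η (fun j => z j s) t}) := by
    intro s _
    by_cases h1 : MD ≤ ∑ t ∈ Finset.Icc 1 T, f t s
    · exact Or.inr (Or.inl h1)
    by_cases h2 : MA ≤ ∑ t ∈ Finset.Icc 1 T, growth ρ K η (fun j => z j s) t
    · exact Or.inr (Or.inr h2)
    refine Or.inl ?_
    push Not at h1 h2
    calc ∑ t ∈ Finset.Icc 1 T, η t * (objective ρ Ω (w t s) - objective ρ Ω v₀)
        ≤ ∑ t ∈ Finset.Icc 1 T, Real.exp MA * f t s := by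
          refine Finset.sum_le_sum fun t ht => ?_
          rw [Finset.mem_Icc] at ht
          have hq := accGrowth_pos (ρ := ρ) hK hη (fun j => z j s) (t + 1)
          have hg : 0 ≤ η t * (objective ρ Ω (w t s) - objective ρ Ω v₀) :=
            mul_nonneg (hη t ht.1) (sub_nonneg.2 (hv₀ _))
          have hle : accGrowth ρ K η (fun j => z j s) (t + 1) ≤ Real.exp MA :=
            (accGrowth_le_exp hK hη _ ht.2).trans (Real.exp_le_exp.2 h2.le)
          simp only [hf, ← mul_assoc]
          rw [mul_assoc (_ * _)]
          refine le_mul_of_one_le_left hg ?_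
          rw [← div_eq_mul_inv, one_le_div hq]
          exact hle
      _ = Real.exp MA * ∑ t ∈ Finset.Icc 1 T, f t s := by rw [Finset.mul_sum]
      _ ≤ _ := by gcongr
  have h1 : (1 : ENNReal) ≤ P {s | ∑ t ∈ Finset.Icc 1 T,
        η t * (objective ρ Ω (w t s) - objective ρ Ω v₀) ≤ Real.exp MA * MD}
      + ENNReal.ofReal δ := by
    rw [← measure_univ (μ := P)]
    refine (measure_mono hcover).trans ((measure_union_le _ _).trans ?_)
    gcongr
    refine (measure_union_le _ _).trans ((add_le_add hU₁ hU₂).trans_eq ?_)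
    rw [← ENNReal.ofReal_add (by positivity) (by positivity), add_halves]
  rw [ENNReal.ofReal_sub _ hδ.le, ENNReal.ofReal_one]
  exact tsub_le_iff_right.2 h1

/-! ### From weighted sums to the averaged iterate -/

theorem iInf_eq_of_mem_minimizers {φ : E d → ℝ} {v₀ : E d} (h : v₀ ∈ minimizers φ) :
    ⨅ u, φ u = φ v₀ :=
  le_antisymm (ciInf_le ⟨φ v₀, by rintro _ ⟨u, rfl⟩; exact h u⟩ v₀) (le_ciInf h)

theorem map_average_sub_le {φ : E d → ℝ} (hφ : ConvexOn ℝ Set.univ φ) {η : ℕ → ℝ}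
    (hη : ∀ t, 1 ≤ t → 0 < η t) (w : ℕ → E d) (c : ℝ) {T : ℕ} (hT : 1 ≤ T) :
    φ (average η w T) - c ≤ (∑ t ∈ Finset.Icc 1 T, η t * (φ (w t) - c))
      / ∑ t ∈ Finset.Icc 1 T, η t := by
  have hpos : 0 < ∑ t ∈ Finset.Icc 1 T, η t :=
    Finset.sum_pos (fun t ht => hη t (Finset.mem_Icc.1 ht).1) ⟨1, Finset.mem_Icc.2 ⟨le_rfl, hT⟩⟩
  have h := hφ.map_centerMass_le (t := Finset.Icc 1 T) (w := η) (p := w)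
    (fun t ht => (hη t (Finset.mem_Icc.1 ht).1).le) hpos fun _ _ => Set.mem_univ _
  simp only [Finset.centerMass, Function.comp_apply, smul_eq_mul] at h
  rw [le_div_iff₀ hpos]
  have h2 := mul_le_mul_of_nonneg_right h hpos.le
  rw [inv_mul_eq_div, div_mul_cancel₀ _ hpos.ne'] at h2
  simp only [mul_sub, Finset.sum_sub_distrib, ← Finset.sum_mul]
  unfold average
  linarith

theorem exists_prob_average_le {ρ : Measure (Example d)} [IsProbabilityMeasure ρ] {κ : ℝ}
    (hκ : 1 ≤ κ) (hb : ∀ᵐ z ∂ρ, ‖z.1‖ ≤ κ) (hp : 0 < posProb ρ) (hp' : posProb ρ < 1)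
    {Ω : E d → ℝ} (hconv : ConvexOn ℝ Set.univ Ω) (hnonneg : ∀ w, 0 ≤ Ω w)
    {A₁ A₂ : ℝ} (hA₁ : 0 ≤ A₁) (hA₂ : 0 ≤ A₂) (hself : SelfBounding Ω A₁ A₂)
    (hmin : (minimizers (objective ρ Ω)).Nonempty) {δ : ℝ} (hδ : 0 < δ)
    {η : ℕ → ℝ} (hη : ∀ t, 1 ≤ t → 0 < η t) (hη' : ∀ t, 1 ≤ t → 2 * A₁ * η t ≤ 1)
    {B₀ : ℝ} (hB₀ : ∀ T, ∑ t ∈ Finset.Icc 1 T, (η t / √t + η t ^ 2) ≤ B₀) :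
    ∃ B : ℝ, 0 ≤ B ∧ ∀ (S : Type u) [MeasurableSpace S] (P : Measure S) [IsProbabilityMeasure P]
      (z : ℕ → S → Example d) (w : ℕ → S → E d), IsSample P ρ z →
      (∀ s, IsIterates Ω η (fun t => z t s) (fun t => w t s)) → ∀ T : ℕ, 1 ≤ T →
      ENNReal.ofReal (1 - δ) ≤ P {s | objective ρ Ω (average η (fun t => w t s) T)
        - ⨅ u, objective ρ Ω u ≤ B / ∑ t ∈ Finset.Icc 1 T, η t} := by
  obtain ⟨v₀, hv₀⟩ := hmin
  obtain ⟨B, hB, h⟩ := exists_prob_weighted_sum_le.{u} hκ hb hp hp' hconv hnonneg hA₁ hA₂ hself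
    hv₀ hδ (fun t ht => (hη t ht).le) hη' hB₀
  refine ⟨B, hB, fun S _ P _ z w hz hw T hT => (h S P z w hz hw T).trans
    (measure_mono fun s hs => ?_)⟩
  rw [Set.mem_ofPred_eq, iInf_eq_of_mem_minimizers hv₀]
  refine (map_average_sub_le ((convexOn_aucRisk hb hp hp').add hconv) hη _ _ hT).trans ?_
  refine div_le_div_of_nonneg_right hs (Finset.sum_nonneg fun t ht => ?_)
  exact (hη t (Finset.mem_Icc.1 ht).1).le

/-! ### Step sizes -/

theorem sum_Icc_le_tsum_of_le {f g : ℕ → ℝ} (hg : Summable g) (hg0 : ∀ t, 0 ≤ g t)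
    (h : ∀ t, 1 ≤ t → f t ≤ g t) (T : ℕ) : ∑ t ∈ Finset.Icc 1 T, f t ≤ ∑' t, g t :=
  (Finset.sum_le_sum fun t ht => h t (Finset.mem_Icc.1 ht).1).trans
    (hg.sum_le_tsum _ fun t _ => hg0 t)

theorem one_le_log_exp_one_mul {t : ℕ} (ht : 1 ≤ t) : 1 ≤ Real.log (Real.exp 1 * t) := by
  have ht' : (1 : ℝ) ≤ t := by exact_mod_cast ht
  rw [Real.log_mul (Real.exp_ne_zero 1) (by positivity), Real.log_exp]
  linarith [Real.log_nonneg ht']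

/-- Cauchy condensation: the k-th condensed term is of order (k + 1)^{-γ}. -/
theorem summable_inv_mul_log_rpow {γ : ℝ} (hγ : 1 < γ) :
    Summable fun t : ℕ => ((t : ℝ) * Real.log (Real.exp 1 * t) ^ γ)⁻¹ := by
  rw [← summable_condensed_iff_of_nonneg]
  · have hl : 0 < Real.log 2 := Real.log_pos one_lt_two
    have hl1 : Real.log 2 ≤ 1 := by linarith [Real.log_two_lt_d9]
    have hs : Summable fun k : ℕ => (Real.log 2 ^ γ)⁻¹ * (((k + 1 : ℕ) : ℝ) ^ γ)⁻¹ :=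
      ((summable_nat_add_iff 1).2 (Real.summable_nat_rpow_inv.2 hγ)).mul_left _
    refine Summable.of_nonneg_of_le (fun k => ?_) (fun k => ?_) hs
    · have := one_le_log_exp_one_mul (t := 2 ^ k) Nat.one_le_two_pow
      positivity
    · have h1 := one_le_log_exp_one_mul (t := 2 ^ k) Nat.one_le_two_pow
      -- Here log (e 2^k) = 1 + k log 2, and 1 ≥ log 2.
      have h2 : Real.log 2 * ((k + 1 : ℕ) : ℝ) ≤ Real.log (Real.exp 1 * (2 ^ k : ℕ)) := by
        rw [Real.log_mul (Real.exp_ne_zero 1) (by positivity), Real.log_exp]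
        push_cast
        rw [Real.log_pow]
        linarith
      rw [← mul_inv, ← Real.mul_rpow hl.le (by positivity), mul_inv]
      push_cast at h1 h2 ⊢
      rw [mul_inv_cancel_left₀ (by positivity)]
      gcongr
  · intro t
    rcases Nat.eq_zero_or_pos t with rfl | ht
    · simp
    · have := one_le_log_exp_one_mul ht
      positivity
  · intro m n hm hmn
    have h1 := one_le_log_exp_one_mul hm
    have hm' : (0 : ℝ) < m := by exact_mod_cast hm
    gcongr

theorem div_sum_le {η : ℕ → ℝ} {B m : ℝ} {T : ℕ} (hT : 1 ≤ T) (hB : 0 ≤ B) (hm : 0 < m)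
    (h : ∀ t, 1 ≤ t → t ≤ T → m ≤ η t) : B / ∑ t ∈ Finset.Icc 1 T, η t ≤ B / (T * m) := by
  have hT' : (0 : ℝ) < T := by exact_mod_cast hT
  have h1 : (T : ℝ) * m ≤ ∑ t ∈ Finset.Icc 1 T, η t := by
    calc (T : ℝ) * m = ∑ t ∈ Finset.Icc 1 T, m := by simp
      _ ≤ _ := Finset.sum_le_sum fun t ht => h t (Finset.mem_Icc.1 ht).1 (Finset.mem_Icc.1 ht).2
  gcongr

theorem log_inv_pos {δ : ℝ} (hδ : 0 < δ) (hδ' : δ < 1) : 0 < Real.log δ⁻¹ :=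
  Real.log_pos ((one_lt_inv₀ hδ).2 hδ')

theorem log_div_eq {δ : ℝ} (hδ : 0 < δ) {T : ℕ} (hT : 1 ≤ T) :
    Real.log (T / δ) = Real.log T + Real.log δ⁻¹ := by
  rw [div_eq_mul_inv, Real.log_mul (by positivity) (by positivity)]

theorem log_inv_le_log_div {δ : ℝ} (hδ : 0 < δ) {T : ℕ} (hT : 1 ≤ T) :
    Real.log δ⁻¹ ≤ Real.log (T / δ) := by
  rw [log_div_eq hδ hT]
  linarith [Real.log_nonneg (show (1 : ℝ) ≤ T by exact_mod_cast hT)]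

/-- Both exponents θ + 1/2 and 2θ exceed 1 exactly when θ > 1/2. -/
theorem polynomial_step_bound {η₁ θ : ℝ} (hη₁ : 0 < η₁) (hθ : 1 / 2 < θ) {η : ℕ → ℝ}
    (hη : ∀ t, 1 ≤ t → η t = η₁ * (t : ℝ) ^ (-θ)) :
    ∃ B₀, ∀ T, ∑ t ∈ Finset.Icc 1 T, (η t / √t + η t ^ 2) ≤ B₀ := by
  have hg : Summable fun t : ℕ => η₁ * (t : ℝ) ^ (-(θ + 1 / 2)) + η₁ ^ 2 * (t : ℝ) ^ (-(2 * θ)) :=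
    ((Real.summable_nat_rpow.2 (by linarith)).mul_left _).add
      ((Real.summable_nat_rpow.2 (by linarith)).mul_left _)
  refine ⟨_, sum_Icc_le_tsum_of_le hg (fun t => by positivity) fun t ht => le_of_eq ?_⟩
  have ht' : (0 : ℝ) < t := by exact_mod_cast ht
  rw [hη t ht, mul_pow, ← Real.rpow_natCast ((t : ℝ) ^ (-θ)), ← Real.rpow_mul ht'.le,
    Real.sqrt_eq_rpow, mul_div_assoc, ← Real.rpow_sub ht']
  congr 3 <;> push_cast <;> ring_nf

/-- The term η_t / √t carries log^{β/2} in the denominator, whence β > 2; η_t² carries log^β and is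
smaller because log (et) ≥ 1. -/
theorem logarithmic_step_bound {η₁ β : ℝ} (hη₁ : 0 < η₁) (hβ : 2 < β) {η : ℕ → ℝ}
    (hη : ∀ t, 1 ≤ t →
      η t = η₁ * ((t : ℝ) * Real.log (Real.exp 1 * t) ^ β) ^ (-(1 / 2) : ℝ)) :
    ∃ B₀, ∀ T, ∑ t ∈ Finset.Icc 1 T, (η t / √t + η t ^ 2) ≤ B₀ := by
  have hg := (summable_inv_mul_log_rpow (show 1 < β / 2 by linarith)).mul_left (η₁ + η₁ ^ 2)
  refine ⟨_, sum_Icc_le_tsum_of_le hg (fun t => ?_) fun t ht => ?_⟩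
  · rcases Nat.eq_zero_or_pos t with rfl | ht
    · simp
    · have := one_le_log_exp_one_mul ht
      positivity
  have ht' : (0 : ℝ) < t := by exact_mod_cast ht
  have hL := one_le_log_exp_one_mul ht
  rw [hη t ht]
  set L := Real.log (Real.exp 1 * t) with hLdef
  have hL0 : 0 < L := by linarith
  have hX : 0 < (t : ℝ) * L ^ β := by positivity
  have e1 : ((t : ℝ) * L ^ β) ^ (-(1 / 2) : ℝ) / √t = (t * L ^ (β / 2))⁻¹ := by
    rw [Real.mul_rpow ht'.le (by positivity), ← Real.rpow_mul hL0.le, Real.sqrt_eq_rpow,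
      mul_div_right_comm, ← Real.rpow_sub ht', mul_inv, ← Real.rpow_neg_one (t : ℝ),
      ← Real.rpow_neg hL0.le]
    congr 2 <;> ring
  have e2 : (((t : ℝ) * L ^ β) ^ (-(1 / 2) : ℝ)) ^ 2 = (t * L ^ β)⁻¹ := by
    rw [← Real.rpow_natCast, ← Real.rpow_mul hX.le, ← Real.rpow_neg_one]
    norm_num
  have h3 : (t * L ^ β)⁻¹ ≤ (t * L ^ (β / 2))⁻¹ := by
    gcongr
    linarith
  rw [mul_pow, e2, mul_div_assoc, e1, add_mul]
  gcongr

/-! ### Rates from the sum of the step sizes -/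

/-- The steps decrease, so their sum is at least T times the last one, which already gives T^{θ-1}.
The logarithmic factor is at least log^{3/2} (1/δ) and is compensated in the constant. -/
theorem div_sum_polynomial_le {η₁ θ δ B : ℝ} (hη₁ : 0 < η₁) (hθ : 1 / 2 < θ) (hδ : 0 < δ)
    (hδ' : δ < 1) (hB : 0 ≤ B) {η : ℕ → ℝ} (hη : ∀ t, 1 ≤ t → η t = η₁ * (t : ℝ) ^ (-θ))
    {T : ℕ} (hT : 1 ≤ T) :
    B / ∑ t ∈ Finset.Icc 1 T, η t ≤ B / (η₁ * Real.log δ⁻¹ ^ (3 / 2 : ℝ)) *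
      ((T : ℝ) ^ (θ - 1) * Real.log (T / δ) ^ (3 / 2 : ℝ)) := by
  have hT' : (0 : ℝ) < T := by exact_mod_cast hT
  have hl := log_inv_pos hδ hδ'
  have hle := log_inv_le_log_div hδ hT
  have h1 := div_sum_le (η := η) (m := η₁ * (T : ℝ) ^ (-θ)) hT hB (by positivity) fun t ht htT => by
    rw [hη t ht]
    have ht' : (0 : ℝ) < t := by exact_mod_cast ht
    refine mul_le_mul_of_nonneg_left ?_ hη₁.le
    exact Real.rpow_le_rpow_of_nonpos ht' (by exact_mod_cast htT) (by linarith)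
  refine h1.trans ?_
  have e : (T : ℝ) * (η₁ * (T : ℝ) ^ (-θ)) = η₁ * ((T : ℝ) ^ (θ - 1))⁻¹ := by
    rw [← Real.rpow_neg hT'.le, neg_sub, sub_eq_add_neg, Real.rpow_add hT', Real.rpow_one]
    ring
  set l := Real.log δ⁻¹
  have e2 : B / (η₁ * ((T : ℝ) ^ (θ - 1))⁻¹) = B / (η₁ * l ^ (3 / 2 : ℝ)) *
      ((T : ℝ) ^ (θ - 1) * l ^ (3 / 2 : ℝ)) := by
    field_simp
  rw [e, e2]
  gcongr

theorem div_sum_logarithmic_le {η₁ β δ B : ℝ} (hη₁ : 0 < η₁) (hβ : 2 < β) (hδ : 0 < δ)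
    (hδ' : δ < 1) (hB : 0 ≤ B) {η : ℕ → ℝ}
    (hη : ∀ t, 1 ≤ t →
      η t = η₁ * ((t : ℝ) * Real.log (Real.exp 1 * t) ^ β) ^ (-(1 / 2) : ℝ))
    {T : ℕ} (hT : 1 ≤ T) :
    B / ∑ t ∈ Finset.Icc 1 T, η t ≤
      B / η₁ * ((1 + (Real.log δ⁻¹)⁻¹) ^ (β / 2) / Real.log δ⁻¹ ^ (3 / 2 : ℝ)) *
      ((T : ℝ) ^ (-(1 / 2) : ℝ) * Real.log (T / δ) ^ ((3 + β) / 2)) := by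
  have hT' : (0 : ℝ) < T := by exact_mod_cast hT
  have hl := log_inv_pos hδ hδ'
  have hle := log_inv_le_log_div hδ hT
  have hL := one_le_log_exp_one_mul hT
  have h1 := div_sum_le (η := η)
    (m := η₁ * ((T : ℝ) * Real.log (Real.exp 1 * T) ^ β) ^ (-(1 / 2) : ℝ)) hT hB (by positivity)
    fun t ht htT => by
      rw [hη t ht]
      have ht' : (0 : ℝ) < t := by exact_mod_cast ht
      have hLt := one_le_log_exp_one_mul ht
      refine mul_le_mul_of_nonneg_left ?_ hη₁.le
      refine Real.rpow_le_rpow_of_nonpos (by positivity) ?_ (by norm_num)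
      gcongr
  refine h1.trans ?_
  -- The summand 1 = log e is written as log (1/δ) / log (1/δ), so log (eT) is controlled by log
  -- (T/δ) even at T = 1.
  have hlog : Real.log (Real.exp 1 * T) ≤ (1 + (Real.log δ⁻¹)⁻¹) * Real.log (T / δ) := by
    have hT0 := Real.log_nonneg (show (1 : ℝ) ≤ T by exact_mod_cast hT)
    rw [log_div_eq hδ hT, Real.log_mul (Real.exp_ne_zero 1) (by positivity), Real.log_exp]
    have h2 : (Real.log δ⁻¹)⁻¹ * Real.log δ⁻¹ = 1 := inv_mul_cancel₀ hl.ne'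
    have h3 : 0 ≤ (Real.log δ⁻¹)⁻¹ * Real.log T := by positivity
    linarith
  set L := Real.log (Real.exp 1 * T)
  set X := Real.log (T / δ)
  set l := Real.log δ⁻¹
  have hL0 : 0 < L := by linarith
  have hX0 : 0 < X := by linarith
  have e : (T : ℝ) * (η₁ * ((T : ℝ) * L ^ β) ^ (-(1 / 2) : ℝ)) =
      η₁ * ((T : ℝ) ^ (-(1 / 2) : ℝ) * L ^ (β / 2))⁻¹ := by
    rw [Real.mul_rpow hT'.le (by positivity), ← Real.rpow_mul hL0.le, mul_inv,
      ← Real.rpow_neg hL0.le, ← Real.rpow_neg hT'.le, neg_neg]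
    have : (T : ℝ) ^ (1 / 2 : ℝ) = T * (T : ℝ) ^ (-(1 / 2) : ℝ) := by
      conv_rhs => rw [← Real.rpow_one_add' hT'.le (by norm_num)]
      norm_num
    rw [this, show β * -(1 / 2) = -(β / 2) by ring]
    ring
  have h4 : L ^ (β / 2) ≤ (1 + l⁻¹) ^ (β / 2) / l ^ (3 / 2 : ℝ) * X ^ ((3 + β) / 2) := by
    calc L ^ (β / 2) ≤ ((1 + l⁻¹) * X) ^ (β / 2) := by gcongr
      _ = (1 + l⁻¹) ^ (β / 2) / l ^ (3 / 2 : ℝ) * (l ^ (3 / 2 : ℝ) * X ^ (β / 2)) := by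
          rw [Real.mul_rpow (by positivity) hX0.le]
          field_simp
      _ ≤ (1 + l⁻¹) ^ (β / 2) / l ^ (3 / 2 : ℝ) * (X ^ (3 / 2 : ℝ) * X ^ (β / 2)) := by gcongr
      _ = _ := by rw [← Real.rpow_add hX0, ← add_div]
  calc B / (T * (η₁ * ((T : ℝ) * L ^ β) ^ (-(1 / 2) : ℝ)))
      = B / η₁ * ((T : ℝ) ^ (-(1 / 2) : ℝ) * L ^ (β / 2)) := by
        rw [e, ← div_div, div_inv_eq_mul]
    _ ≤ B / η₁ * ((T : ℝ) ^ (-(1 / 2) : ℝ) *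
        ((1 + l⁻¹) ^ (β / 2) / l ^ (3 / 2 : ℝ) * X ^ ((3 + β) / 2))) := by gcongr
    _ = _ := by ring

/-! ### The constants κ and C₁ -/

theorem one_le_kappa (X : Set (E d)) : 1 ≤ kappa X := le_max_left _ _

theorem norm_le_kappa {X : Set (E d)} (hX : Bornology.IsBounded X) {x : E d} (hx : x ∈ X) :
    ‖x‖ ≤ kappa X := by
  refine le_trans (le_csSup ?_ (Set.mem_image_of_mem _ hx)) (le_max_right _ _)
  obtain ⟨c, hc⟩ := hX.exists_norm_le
  exact ⟨c, by rintro _ ⟨y, hy, rfl⟩; exact hc y hy⟩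

theorem two_mul_mul_le_one {X : Set (E d)} {A₁ η₁ r : ℝ} (hA₁ : 0 ≤ A₁)
    (hη₁ : η₁ ≤ (2 * constC₁ X A₁)⁻¹) (hr : r ≤ η₁) : 2 * A₁ * r ≤ 1 := by
  have hC : 0 < constC₁ X A₁ :=
    lt_max_of_lt_right (by have := one_le_kappa X; positivity)
  have hAC : A₁ ≤ constC₁ X A₁ := le_max_left _ _
  calc 2 * A₁ * r ≤ 2 * A₁ * (2 * constC₁ X A₁)⁻¹ := by gcongr; exact hr.trans hη₁
    _ ≤ 2 * constC₁ X A₁ * (2 * constC₁ X A₁)⁻¹ := by gcongr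
    _ = 1 := mul_inv_cancel₀ (by positivity)

end SPAUC

end

theorem mainTheorem4 {d : ℕ}
    -- bounded input domain and sampling distribution, both classes having positive probability
    (X : Set (SPAUC.E d)) (hX : Bornology.IsBounded X)
    (ρ : Measure (SPAUC.Example d)) [IsProbabilityMeasure ρ]
    (hρX : ∀ᵐ z ∂ρ, z.1 ∈ X)
    (hp : 0 < SPAUC.posProb ρ) (hp' : SPAUC.posProb ρ < 1)
    -- self-bounding convex regularizer
    (Ω : SPAUC.E d → ℝ) (hconv : ConvexOn ℝ Set.univ Ω) (hnonneg : ∀ w, 0 ≤ Ω w)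
    (hzero : Ω 0 = 0)
    (A₁ A₂ : ℝ) (hA₁ : 0 ≤ A₁) (hA₂ : 0 ≤ A₂) (hself : SPAUC.SelfBounding Ω A₁ A₂)
    (hmin : (SPAUC.minimizers (SPAUC.objective ρ Ω)).Nonempty)
    (η₁ : ℝ) (hη₁ : 0 < η₁) (hη₁' : η₁ ≤ (2 * SPAUC.constC₁ X A₁)⁻¹)
    (δ : ℝ) (hδ : 0 < δ) (hδ' : δ < 1) :
    (∀ θ : ℝ, 1 / 2 < θ → ∀ η : ℕ → ℝ, (∀ t, 1 ≤ t → η t = η₁ * (t : ℝ) ^ (-θ)) →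
      ∃ C : ℝ, ∀ (S : Type u) [MeasurableSpace S] (P : Measure S) [IsProbabilityMeasure P]
        (z : ℕ → S → SPAUC.Example d) (w : ℕ → S → SPAUC.E d), SPAUC.IsSample P ρ z →
        (∀ s, SPAUC.IsIterates Ω η (fun t => z t s) (fun t => w t s)) →
        ∀ T : ℕ, 1 ≤ T →
          ENNReal.ofReal (1 - δ) ≤
            P {s | SPAUC.objective ρ Ω (SPAUC.average η (fun t => w t s) T)
                - ⨅ u, SPAUC.objective ρ Ω u
              ≤ C * ((T : ℝ) ^ (θ - 1) * Real.log (T / δ) ^ (3 / 2 : ℝ))}) ∧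
    (∀ β : ℝ, 2 < β → ∀ η : ℕ → ℝ,
      (∀ t, 1 ≤ t →
        η t = η₁ * ((t : ℝ) * Real.log (Real.exp 1 * t) ^ β) ^ (-(1 / 2) : ℝ)) →
      ∃ C : ℝ, ∀ (S : Type u) [MeasurableSpace S] (P : Measure S) [IsProbabilityMeasure P]
        (z : ℕ → S → SPAUC.Example d) (w : ℕ → S → SPAUC.E d), SPAUC.IsSample P ρ z →
        (∀ s, SPAUC.IsIterates Ω η (fun t => z t s) (fun t => w t s)) →
        ∀ T : ℕ, 1 ≤ T →
          ENNReal.ofReal (1 - δ) ≤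
            P {s | SPAUC.objective ρ Ω (SPAUC.average η (fun t => w t s) T)
                - ⨅ u, SPAUC.objective ρ Ω u
              ≤ C * ((T : ℝ) ^ (-(1 / 2) : ℝ)
                  * Real.log (T / δ) ^ ((3 + β) / 2))}) := by
  have hκ := SPAUC.one_le_kappa X
  have hb : ∀ᵐ z ∂ρ, ‖z.1‖ ≤ SPAUC.kappa X := hρX.mono fun z hz => SPAUC.norm_le_kappa hX hz
  constructor
  · intro θ hθ η hη
    have hpos : ∀ t, 1 ≤ t → 0 < η t := fun t ht => by
      have ht' : (0 : ℝ) < t := by exact_mod_cast ht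
      rw [hη t ht]
      positivity
    have hle : ∀ t, 1 ≤ t → 2 * A₁ * η t ≤ 1 := fun t ht => by
      refine SPAUC.two_mul_mul_le_one hA₁ hη₁' ?_
      rw [hη t ht]
      exact mul_le_of_le_one_right hη₁.le
        (Real.rpow_le_one_of_one_le_of_nonpos (by exact_mod_cast ht) (by linarith))
    obtain ⟨B₀, hB₀⟩ := SPAUC.polynomial_step_bound hη₁ hθ hη
    obtain ⟨B, hB, h⟩ := SPAUC.exists_prob_average_le.{u} hκ hb hp hp' hconv hnonneg hA₁ hA₂ hself
      hmin hδ hpos hle hB₀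
    refine ⟨B / (η₁ * Real.log δ⁻¹ ^ (3 / 2 : ℝ)), fun S _ P _ z w hz hw T hT => (h S P z w hz hw T hT).trans
      (measure_mono fun s hs => ?_)⟩
    exact le_trans hs (SPAUC.div_sum_polynomial_le hη₁ hθ hδ hδ' hB hη hT)
  · intro β hβ η hη
    have hpos : ∀ t, 1 ≤ t → 0 < η t := fun t ht => by
      have ht' : (0 : ℝ) < t := by exact_mod_cast ht
      have := SPAUC.one_le_log_exp_one_mul ht
      rw [hη t ht]
      positivity
    have hle : ∀ t, 1 ≤ t → 2 * A₁ * η t ≤ 1 := fun t ht => by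
      refine SPAUC.two_mul_mul_le_one hA₁ hη₁' ?_
      rw [hη t ht]
      have ht' : (1 : ℝ) ≤ t := by exact_mod_cast ht
      have := Real.one_le_rpow (SPAUC.one_le_log_exp_one_mul ht) (show 0 ≤ β by linarith)
      exact mul_le_of_le_one_right hη₁.le
        (Real.rpow_le_one_of_one_le_of_nonpos (one_le_mul_of_one_le_of_one_le ht' this)
          (by norm_num))
    obtain ⟨B₀, hB₀⟩ := SPAUC.logarithmic_step_bound hη₁ hβ hη
    obtain ⟨B, hB, h⟩ := SPAUC.exists_prob_average_le.{u} hκ hb hp hp' hconv hnonneg hA₁ hA₂ hself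
      hmin hδ hpos hle hB₀
    refine ⟨B / η₁ * ((1 + (Real.log δ⁻¹)⁻¹) ^ (β / 2) / Real.log δ⁻¹ ^ (3 / 2 : ℝ)),
      fun S _ P _ z w hz hw T hT => (h S P z w hz hw T hT).trans
      (measure_mono fun s hs => ?_)⟩
    exact le_trans hs (SPAUC.div_sum_logarithmic_le hη₁ hβ hδ hδ' hB hη hT)
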